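/- Let $d\ge 1$, let $s\ge 1$ be an integer, let $\beta>-d$ and let $\lambda_0,\dots,\lambda_{s-1}>0$. Let $\mathbb V_0^{d+1}=\{(x,t)\in\mathbb R^d\times[0,1]:\|x\|=t\}$ be the conic surface, with measure $\int f\,d\mathsf m=\int_0^1 t^{d-1}\int_{\mathbb S^{d-1}}f(t\xi,t)\,d\sigma(\xi)\,dt$, let $\omega_d$ be the area of $\mathbb S^{d-1}$, and let $\mathsf w_{\beta,\gamma}(t)=t^\beta(1-t)^\gamma$. *Derivative.* On functions on $\mathbb V_0^{d+1}$, $\partial_t$ is the derivative in $t$ that treats solid harmonics as constants: $\partial_t[q(t)Y(x)]=q'(t)Y(x)$ for every homogeneous harmonic polynomial $Y$ on $\mathbb R^d$. In general, $G=\partial_tF$ means that for every $m\ge 0$ and every homogeneous harmonic polynomial $Y$ of degree $m$ the function $t\mapsto t^{-m}\frac1{\omega_d}\int_{\mathbb S^{d-1}}F(t\xi,t)Y(\xi)\,d\sigma(\xi)$ is locally absolutely continuous on $(0,1]$, with a.e. derivative the corresponding function for $G$. Here the derivatives $\partial_t^kf$ with $k<s$ are required to have restrictions in $L^2$ to every sphere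 $\{(t\xi,t):\xi\in\mathbb S^{d-1}\}$, $0<t\le1$, and $\partial_t^sf$ is required to be measurable and to have restrictions in $L^2$ to almost every such sphere. Let $W_2^s$ be the space of continuous $f$ on $\mathbb V_0^{d+1}$ that have derivatives $\partial_t^kf$, $k\le s$, in this sense, with $\partial_t^sf\in L^2(\mathbb V_0^{d+1},\mathsf w_{\beta+s,0})$. *Projections.* Put $$\langle f,g\rangle_{\beta,s}=b_{\beta,s}\int_{\mathbb V_0^{d+1}}fg\,\mathsf w_{\beta,s}\,d\mathsf m,\qquad b_{\beta,s}=\frac1{\omega_d}\,\frac{\Gamma(\beta+d+s+1)}{\Gamma(\beta+d)\Gamma(s+1)},$$ $$\langle f,g\rangle_{\beta,-s}=\frac1{\omega_d}\int_{\mathbb V_0^{d+1}}\partial_t^sf\,\partial_t^sg\,t^{\beta+s}\,d\mathsf m+\sum_{k=0}^{s-1}\frac{\lambda_k}{\omega_d}\int_{\mathbb S^{d-1}}\partial_t^kf(\xi,1)\,\partial_t^kg(\xi,1)\,d\sigma(\xi).$$ For $n\ge 0$ let $\mathcal V_n^d(\mathsf w_{\beta,\pm s})$ be the space of polynomials of degree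 at most $n$ on $\mathbb V_0^{d+1}$ that are orthogonal, with respect to $\langle\cdot,\cdot\rangle_{\beta,\pm s}$, to all polynomials of degree less than $n$, and let $\operatorname{proj}_n^{\beta,\pm s}$ be the orthogonal projection onto it; put $\operatorname{proj}_n^{\beta,s}=0$ for $n<0$. **Theorem.** Let $f\in W_2^s$ and $g\in L^2(\mathbb V_0^{d+1},\mathsf w_{\beta,s})$ satisfy $f(x,t)=(1-t)^sg(x,t)$ on $\mathbb V_0^{d+1}$, where $f$ vanishes to order $s$ at the rim $t=1$ in the sense that $\int_{\mathbb S^{d-1}}|(1-t)g(t\xi,t)|^2\,d\sigma(\xi)\to0$ as $t\to1^-$ (which holds, for example, whenever $g$ is bounded near the rim). Then for every $n\ge0$ the projections $\operatorname{proj}_n^{\beta,-s}f$ and $\operatorname{proj}_n^{\beta,s}g$ exist and are unique, and $$\operatorname{proj}_n^{\beta,-s}f=(1-t)^s\operatorname{proj}_{n-s}^{\beta,s}g\quad\text{on }\mathbb V_0^{d+1};$$ in particular $\operatorname{proj}_n^{\beta,-s}f=0$ for $n<s$. -/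

import Mathlib

open MeasureTheory Filter Topology

noncomputable section

/-- The conic surface `{(x, t) ∈ ℝ^d × ℝ : ‖x‖ = t, 0 ≤ t ≤ 1}`. -/
abbrev ConeSurface (d : ℕ) : Type :=
  {p : EuclideanSpace ℝ (Fin d) × ℝ // ‖p.1‖ = p.2 ∧ 0 ≤ p.2 ∧ p.2 ≤ 1}

/-- The unit sphere of `ℝ^d`. -/
abbrev UnitSphere (d : ℕ) : Type := Metric.sphere (0 : EuclideanSpace ℝ (Fin d)) 1

/-- The surface (Lebesgue) measure `dσ` of the unit sphere. -/
def sphereMeasure (d : ℕ) : Measure (UnitSphere d) :=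
  (volume : Measure (EuclideanSpace ℝ (Fin d))).toSphere

/-- The surface area `ω_d` of the unit sphere. -/
def sphereArea (d : ℕ) : ℝ := (sphereMeasure d).real Set.univ

/-- The point `(t ξ, t)` of the conic surface, for `t ∈ [0, 1]` and `‖ξ‖ = 1`
(real numbers outside `[0, 1]` are first clamped to `[0, 1]`). -/
def conePoint {d : ℕ} (t : ℝ) (ξ : UnitSphere d) : ConeSurface d :=
  ⟨((max 0 (min t 1)) • (ξ : EuclideanSpace ℝ (Fin d)), max 0 (min t 1)), by
    have h0 : (0 : ℝ) ≤ max 0 (min t 1) := le_max_left _ _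
    have h1 : max 0 (min t 1) ≤ (1 : ℝ) := max_le zero_le_one (min_le_right _ _)
    have hξ : ‖(ξ : EuclideanSpace ℝ (Fin d))‖ = 1 := by simp
    refine ⟨?_, h0, h1⟩
    simp only [norm_smul, hξ, mul_one, Real.norm_eq_abs]
    exact abs_of_nonneg h0⟩

theorem conePoint_val {d : ℕ} {t : ℝ} (h0 : 0 ≤ t) (h1 : t ≤ 1) (ξ : UnitSphere d) :
    (conePoint t ξ).1 = (t • (ξ : EuclideanSpace ℝ (Fin d)), t) := by
  simp [conePoint, min_eq_left h1, max_eq_right h0]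

theorem continuous_conePoint (d : ℕ) :
    Continuous (fun p : ℝ × UnitSphere d => conePoint p.1 p.2) := by
  unfold conePoint
  fun_prop

/-- The measure `dm` of the conic surface:
`∫ f dm = ∫_0^1 t^(d-1) ∫_{S^(d-1)} f(tξ, t) dσ(ξ) dt`. -/
def coneMeasure (d : ℕ) : Measure (ConeSurface d) :=
  ((((volume : Measure ℝ).restrict (Set.Ioc 0 1)).withDensity
      (fun t => ENNReal.ofReal (t ^ (d - 1)))).prod (sphereMeasure d)).map
    (fun p : ℝ × UnitSphere d => conePoint p.1 p.2)

/-- The measure `w_{β,γ}(t) dm` with `w_{β,γ}(t) = t^β (1-t)^γ`. -/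
def weightedConeMeasure (d : ℕ) (β γ : ℝ) : Measure (ConeSurface d) :=
  (coneMeasure d).withDensity
    (fun p => ENNReal.ofReal (p.1.2 ^ β * (1 - p.1.2) ^ γ))

/-- The normalization constant `b_{β,γ}`. -/
def coneNormConst (d : ℕ) (β γ : ℝ) : ℝ :=
  (1 / sphereArea d) *
    (Real.Gamma (β + d + γ + 1) / (Real.Gamma (β + d) * Real.Gamma (γ + 1)))

/-- The inner product `⟨f, g⟩_{β,γ} = b_{β,γ} ∫ f g w_{β,γ} dm`. -/
def coneInner {d : ℕ} (β γ : ℝ) (f g : ConeSurface d → ℝ) : ℝ :=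
  coneNormConst d β γ * ∫ p, f p * g p ∂(weightedConeMeasure d β γ)

/-- `Y` is a solid harmonic of degree `m`: a homogeneous polynomial of degree `m` in `d`
variables with `Δ Y = 0`. -/
def IsSolidHarmonic {d : ℕ} (m : ℕ) (Y : MvPolynomial (Fin d) ℝ) : Prop :=
  Y.IsHomogeneous m ∧ ∑ i : Fin d, MvPolynomial.pderiv i (MvPolynomial.pderiv i Y) = 0

/-- The coefficient function `t ↦ t^(-m) (1/ω_d) ∫ F(tξ, t) Y(ξ) dσ(ξ)`, where `Y` is a solid
harmonic of degree `m`. If `F(x,t) = ∑ q_{j,ℓ}(t) Y_{j,ℓ}(x)` with `Y_{j,ℓ}` an orthonormal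
family of solid harmonics of degree `j`, then the coefficient for `Y_{m,ℓ}` is `q_{m,ℓ}(t)`. -/
def harmonicCoeff {d : ℕ} (F : ConeSurface d → ℝ) (m : ℕ) (Y : MvPolynomial (Fin d) ℝ)
    (t : ℝ) : ℝ :=
  (t ^ m)⁻¹ * ((1 / sphereArea d) * ∫ ξ : UnitSphere d,
    F (conePoint t ξ) * MvPolynomial.eval (fun i => (ξ : EuclideanSpace ℝ (Fin d)) i) Y
      ∂(sphereMeasure d))

/-- `G = ∂_t F` on the conic surface. The derivative `∂_t` is the one for which solid harmonics
`Y(x)` are constants, `∂_t [q(t) Y(x)] = q'(t) Y(x)`: every coefficient function of `F` is locally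
absolutely continuous on `(0, 1]` and its derivative is the coefficient function of `G`. -/
def IsTDeriv {d : ℕ} (F G : ConeSurface d → ℝ) : Prop :=
  ∀ (m : ℕ) (Y : MvPolynomial (Fin d) ℝ), IsSolidHarmonic m Y →
    ∀ t ∈ Set.Ioc (0 : ℝ) 1,
      IntervalIntegrable (harmonicCoeff G m Y) volume t 1 ∧
      harmonicCoeff F m Y 1 - harmonicCoeff F m Y t = ∫ v in t..1, harmonicCoeff G m Y v

/-- `F 0, F 1, …, F s` are successive derivatives `∂_t^k (F 0)`. Those of order `k < s` have traces
in `L²` of every sphere `{(tξ, t)}`, `0 < t ≤ 1`; the last one is a measurable function with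
traces in `L²` for almost every `t`. -/
structure IsTDerivChain {d : ℕ} (s : ℕ) (F : ℕ → ConeSurface d → ℝ) : Prop where
  slice : ∀ k < s, ∀ t ∈ Set.Ioc (0 : ℝ) 1,
    MemLp (fun ξ : UnitSphere d => F k (conePoint t ξ)) 2 (sphereMeasure d)
  meas_top : AEStronglyMeasurable (F s) (coneMeasure d)
  slice_top : ∀ᵐ t ∂((volume : Measure ℝ).restrict (Set.Ioc 0 1)),
    MemLp (fun ξ : UnitSphere d => F s (conePoint t ξ)) 2 (sphereMeasure d)
  deriv : ∀ k < s, IsTDeriv (F k) (F (k + 1))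

/-- `f` has derivatives `∂_t^k f` for `k ≤ s`. -/
def HasTDerivs {d : ℕ} (s : ℕ) (f : ConeSurface d → ℝ) : Prop :=
  ∃ F : ℕ → ConeSurface d → ℝ, F 0 = f ∧ IsTDerivChain s F

open Classical in
/-- The derivative `∂_t^k f`, `k ≤ s`, of a function with derivatives up to order `s`
(for `k < s` it is determined almost everywhere on each sphere `{(tξ, t)}`, in particular on the
rim `t = 1`; for `k = s` it is determined almost everywhere on the surface). -/
def tDeriv {d : ℕ} (s : ℕ) (f : ConeSurface d → ℝ) (k : ℕ) : ConeSurface d → ℝ :=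
  if h : HasTDerivs s f then h.choose k else 0

/-- The Sobolev space `W_2^s` for the weight `w_{β+s,0}`. -/
def MemConeSobolev {d : ℕ} (β : ℝ) (s : ℕ) (f : ConeSurface d → ℝ) : Prop :=
  Continuous f ∧ HasTDerivs s f ∧
    MemLp (tDeriv s f s) 2 (weightedConeMeasure d (β + s) 0)

/-- The Sobolev inner product
`⟨f, g⟩_{β,-s} = (1/ω_d) ∫ ∂_t^s f ∂_t^s g t^(β+s) dm
  + ∑_{k<s} (lam_k/ω_d) ∫_{S^(d-1)} ∂_t^k f(ξ,1) ∂_t^k g(ξ,1) dσ(ξ)`. -/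
def coneSobolevInner {d : ℕ} (β : ℝ) (s : ℕ) (lam : ℕ → ℝ) (f g : ConeSurface d → ℝ) : ℝ :=
  (1 / sphereArea d) *
      ∫ p, tDeriv s f s p * tDeriv s g s p ∂(weightedConeMeasure d (β + s) 0) +
    ∑ k ∈ Finset.range s, (lam k / sphereArea d) *
      ∫ ξ : UnitSphere d, tDeriv s f k (conePoint 1 ξ) * tDeriv s g k (conePoint 1 ξ)
        ∂(sphereMeasure d)

/-- `q` is the restriction to the conic surface of a polynomial in `(x, t)` of total degree at
most `n`. -/
def IsConePoly {d : ℕ} (n : ℕ) (q : ConeSurface d → ℝ) : Prop :=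
  ∃ P : MvPolynomial (Fin d ⊕ Unit) ℝ, P.totalDegree ≤ n ∧
    ∀ p : ConeSurface d,
      q p = MvPolynomial.eval (Sum.elim (fun i => p.1.1 i) (fun _ => p.1.2)) P

/-- The orthogonal polynomials of degree `n` for the bilinear form `ip`: polynomials of degree at
most `n` on the conic surface that are orthogonal to all polynomials of lower degree. -/
def orthPolys {d : ℕ} (ip : (ConeSurface d → ℝ) → (ConeSurface d → ℝ) → ℝ) (n : ℕ) :
    Set (ConeSurface d → ℝ) :=
  {q | IsConePoly n q ∧ ∀ m < n, ∀ r : ConeSurface d → ℝ, IsConePoly m r → ip q r = 0}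

/-- `p` is the orthogonal projection of `f` onto `V` with respect to `ip`. -/
def IsOrthProj {d : ℕ} (ip : (ConeSurface d → ℝ) → (ConeSurface d → ℝ) → ℝ)
    (V : Set (ConeSurface d → ℝ)) (f p : ConeSurface d → ℝ) : Prop :=
  p ∈ V ∧ ∀ v ∈ V, ip f v = ip p v

open Classical in
/-- The orthogonal projection of `f` onto `V` with respect to `ip`. -/
def orthProj {d : ℕ} (ip : (ConeSurface d → ℝ) → (ConeSurface d → ℝ) → ℝ)
    (V : Set (ConeSurface d → ℝ)) (f : ConeSurface d → ℝ) : ConeSurface d → ℝ :=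
  if h : ∃ p, IsOrthProj ip V f p then h.choose else 0

/-- The space `V_n(w_{β,γ})` of orthogonal polynomials of degree `n`. -/
def coneV (d : ℕ) (β γ : ℝ) (n : ℕ) : Set (ConeSurface d → ℝ) :=
  orthPolys (coneInner β γ) n

/-- The space `V_n(w_{β,-s})` of Sobolev orthogonal polynomials of degree `n`. -/
def coneSobolevV (d : ℕ) (β : ℝ) (s : ℕ) (lam : ℕ → ℝ) (n : ℕ) : Set (ConeSurface d → ℝ) :=
  orthPolys (coneSobolevInner β s lam) n

/-- The projection `proj_n^{β,γ}`. -/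
def coneProj {d : ℕ} (β γ : ℝ) (n : ℕ) (g : ConeSurface d → ℝ) : ConeSurface d → ℝ :=
  orthProj (coneInner β γ) (coneV d β γ n) g

/-- The Sobolev projection `proj_n^{β,-s}`. -/
def coneSobolevProj {d : ℕ} (β : ℝ) (s : ℕ) (lam : ℕ → ℝ) (n : ℕ) (f : ConeSurface d → ℝ) :
    ConeSurface d → ℝ :=
  orthProj (coneSobolevInner β s lam) (coneSobolevV d β s lam n) f

end

/-! The theorem is a duality. If `f = (1-t)^s g` vanishes to order `s` at the rim, then for each
polynomial `v` of degree at most `n` there is a polynomial `w` of degree at most `n - s`, depending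
on `v` but not on the pair, with `⟨f, v⟩_{β,-s} = ⟨g, w⟩_{β,s}`; and `w = 0` when `n < s`.

To see this, write `v` as a combination of functions `t^k Y(x)` with `Y` a solid harmonic of degree
`m`. This is possible because a polynomial in `x` is a sum of terms `‖x‖^(2j) Y(x)` (Fischer) and
`‖x‖ = t` on the cone. Let `φ` be the coefficient of `f` along `Y`. The rim terms vanish because `φ`
and its first `s - 1` derivatives are zero at `t = 1`. What remains is a multiple of `∫ φ^(s)
t^(b+s) dt` with `b = β + d - 1 + (k-s) + 2m`. Integrating by parts `s` times gives a nonzero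
multiple of `∫ φ t^b dt`, which up to a constant is the moment of `g` against `t^(k-s) Y` for the
weight `t^β (1-t)^s`. So `w` is a multiple of `t^(k-s) Y`, and it is zero if `k < s`.

The identity also applies with a polynomial `q` in place of `g`. If `q` is orthogonal of degree `n -
s`, it makes `(1-t)^s q` Sobolev orthogonal of degree `n`. If `v` is Sobolev orthogonal of degree
`n`, it makes `w` orthogonal of degree `n - s`. Hence the equations characterizing `proj_{n-s} g`
turn into those for `proj_n f`.

The carrying lemmas are `mem_span_fischer`, `IsACChain.eq_zero_of_rim` (order of vanishing),
`IsACChain.integral_mul_rpow` (integration by parts) and `exists_dual_conePoly` (duality). Since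
`tDeriv` is a choice, `IsTDerivChain.unique` is needed to compute with it; it rests on the
completeness of solid harmonics in `L²` of the sphere. -/

noncomputable section

/-! ### Fischer decomposition and polynomials on the cone -/

section Fischer

open MvPolynomial

variable {d : ℕ}

/-- The Laplacian on polynomials in `d` variables. -/
def polyLaplacian (d : ℕ) : MvPolynomial (Fin d) ℝ →ₗ[ℝ] MvPolynomial (Fin d) ℝ :=
  ∑ i : Fin d, (pderiv i).toLinearMap ∘ₗ (pderiv i).toLinearMap

theorem polyLaplacian_apply (P : MvPolynomial (Fin d) ℝ) :
    polyLaplacian d P = ∑ i : Fin d, pderiv i (pderiv i P) := by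
  simp [polyLaplacian]

/-- The polynomial `x_1^2 + ⋯ + x_d^2`. -/
def polyNormSq (d : ℕ) : MvPolynomial (Fin d) ℝ := ∑ i : Fin d, X i ^ 2

theorem isHomogeneous_polyNormSq : (polyNormSq d).IsHomogeneous 2 :=
  IsHomogeneous.sum _ _ _ fun i _ => by simpa using (isHomogeneous_X ℝ i).pow 2

theorem pderiv_polyNormSq (i : Fin d) : pderiv i (polyNormSq d) = 2 * X i := by
  classical
  simp only [polyNormSq, map_sum, pderiv_pow, pderiv_X]
  rw [Finset.sum_eq_single i]
  · simp
  · intro j _ hj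
    simp [hj.symm]
  · simp

/-- The cross term `4 ∑ x_i ∂_i Q` equals `4 n Q` by Euler's identity, and `Δ‖x‖² = 2d`. -/
theorem polyLaplacian_polyNormSq_mul {n : ℕ} {Q : MvPolynomial (Fin d) ℝ}
    (hQ : Q.IsHomogeneous n) :
    polyLaplacian d (polyNormSq d * Q) =
      polyNormSq d * polyLaplacian d Q + (4 * n + 2 * d : ℝ) • Q := by
  have key : ∀ i : Fin d, pderiv i (pderiv i (polyNormSq d * Q)) =
      polyNormSq d * pderiv i (pderiv i Q) + 4 * (X i * pderiv i Q) + 2 * Q := by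
    intro i
    have h2 : pderiv i (2 : MvPolynomial (Fin d) ℝ) = 0 := by
      rw [← map_ofNat (C : ℝ →+* MvPolynomial (Fin d) ℝ) 2, pderiv_C]
    simp only [pderiv_mul, map_add, pderiv_polyNormSq, pderiv_X_self, h2]
    ring
  simp only [polyLaplacian_apply, key, Finset.sum_add_distrib, ← Finset.mul_sum,
    hQ.sum_X_mul_pderiv]
  simp only [Finset.sum_const, Finset.card_univ, Fintype.card_fin, MvPolynomial.smul_eq_C_mul,
    map_add, map_mul, map_natCast, nsmul_eq_mul]
  simp only [map_ofNat]
  ring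

theorem IsSolidHarmonic.isHomogeneous_mul {m : ℕ} {Y : MvPolynomial (Fin d) ℝ}
    (hY : IsSolidHarmonic m Y) (j : ℕ) :
    (polyNormSq d ^ j * Y).IsHomogeneous (2 * j + m) :=
  (isHomogeneous_polyNormSq.pow j).mul hY.1

theorem IsSolidHarmonic.polyLaplacian_eq_zero {m : ℕ} {Y : MvPolynomial (Fin d) ℝ}
    (hY : IsSolidHarmonic m Y) : polyLaplacian d Y = 0 := by
  rw [polyLaplacian_apply]; exact hY.2

theorem IsSolidHarmonic.smul {m : ℕ} {Y : MvPolynomial (Fin d) ℝ}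
    (hY : IsSolidHarmonic m Y) (c : ℝ) : IsSolidHarmonic m (c • Y) := by
  refine ⟨(homogeneousSubmodule (Fin d) ℝ m).smul_mem c hY.1, ?_⟩
  rw [← polyLaplacian_apply, map_smul, hY.polyLaplacian_eq_zero, smul_zero]

/-- Each application of the product formula adds a positive constant, so `Δ` lowers the power of
`‖x‖²` by one without killing the term. -/
theorem polyLaplacian_pow_mul (hd : 1 ≤ d) {m : ℕ} {Y : MvPolynomial (Fin d) ℝ}
    (hY : IsSolidHarmonic m Y) (j : ℕ) :
    ∃ c : ℝ, 0 < c ∧ polyLaplacian d (polyNormSq d ^ (j + 1) * Y) =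
      c • (polyNormSq d ^ j * Y) := by
  have hd' : (1 : ℝ) ≤ d := by exact_mod_cast hd
  induction j with
  | zero =>
    refine ⟨4 * m + 2 * d, by positivity, ?_⟩
    rw [zero_add, pow_one, polyLaplacian_polyNormSq_mul hY.1, hY.polyLaplacian_eq_zero]
    simp
  | succ j ih =>
    obtain ⟨c, hc, h⟩ := ih
    refine ⟨c + (4 * (2 * (j + 1) + m : ℕ) + 2 * d), by positivity, ?_⟩
    rw [pow_succ' _ (j + 1), mul_assoc, polyLaplacian_polyNormSq_mul (hY.isHomogeneous_mul (j + 1)),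
      h, mul_smul_comm, ← mul_assoc, ← pow_succ', add_smul c]

theorem polyLaplacian_iterate_pow_mul (hd : 1 ≤ d) {m : ℕ} {Y : MvPolynomial (Fin d) ℝ}
    (hY : IsSolidHarmonic m Y) (j : ℕ) :
    ∃ c : ℝ, 0 < c ∧ (polyLaplacian d ^ j) (polyNormSq d ^ j * Y) = c • Y := by
  induction j with
  | zero => exact ⟨1, one_pos, by simp⟩
  | succ j ih =>
    obtain ⟨c, hc, h⟩ := ih
    obtain ⟨c', hc', h'⟩ := polyLaplacian_pow_mul hd hY j
    exact ⟨c' * c, by positivity, by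
      rw [pow_succ, Module.End.mul_apply, h', map_smul, h, mul_smul]⟩

theorem isHomogeneous_polyLaplacian {n : ℕ} {P : MvPolynomial (Fin d) ℝ}
    (hP : P.IsHomogeneous n) : (polyLaplacian d P).IsHomogeneous (n - 2) := by
  rw [polyLaplacian_apply]
  exact IsHomogeneous.sum _ _ _ fun i _ => hP.pderiv.pderiv

theorem isHomogeneous_polyLaplacian_pow {n : ℕ} {P : MvPolynomial (Fin d) ℝ}
    (hP : P.IsHomogeneous n) (k : ℕ) : ((polyLaplacian d ^ k) P).IsHomogeneous (n - 2 * k) := by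
  induction k with
  | zero => simpa
  | succ k ih =>
    rw [pow_succ', Module.End.mul_apply]
    have := isHomogeneous_polyLaplacian ih
    rwa [show n - 2 * k - 2 = n - 2 * (k + 1) by omega] at this

theorem polyLaplacian_eq_zero_of_lt_two {n : ℕ} (hn : n < 2) {P : MvPolynomial (Fin d) ℝ}
    (hP : P.IsHomogeneous n) : polyLaplacian d P = 0 := by
  rw [polyLaplacian_apply]
  refine Finset.sum_eq_zero fun i _ => ?_
  have h : (pderiv i P).IsHomogeneous 0 := by
    have := hP.pderiv (i := i)
    rwa [show n - 1 = 0 by omega] at this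
  rw [← totalDegree_zero_iff_isHomogeneous, totalDegree_eq_zero_iff_eq_C] at h
  rw [h, pderiv_C]

theorem polyLaplacian_pow_eq_zero {n k : ℕ} (hn : n < 2 * k) {P : MvPolynomial (Fin d) ℝ}
    (hP : P.IsHomogeneous n) : (polyLaplacian d ^ k) P = 0 := by
  induction k with
  | zero => omega
  | succ k ih =>
    rw [pow_succ', Module.End.mul_apply]
    by_cases h : n < 2 * k
    · rw [ih h, map_zero]
    · exact polyLaplacian_eq_zero_of_lt_two (by omega) (isHomogeneous_polyLaplacian_pow hP k)

/-- **Fischer decomposition**: a homogeneous polynomial is a sum of terms `‖x‖^(2j) Y(x)` with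
`Y` a solid harmonic. -/
theorem mem_span_fischer (hd : 1 ≤ d) {n : ℕ} {P : MvPolynomial (Fin d) ℝ}
    (hP : P.IsHomogeneous n) :
    P ∈ Submodule.span ℝ {Q : MvPolynomial (Fin d) ℝ | ∃ j m Y, 2 * j + m = n ∧
      IsSolidHarmonic m Y ∧ Q = polyNormSq d ^ j * Y} := by
  -- The induction runs on the power of the Laplacian that kills `P`, at fixed degree `n`.
  suffices H : ∀ k : ℕ, ∀ P : MvPolynomial (Fin d) ℝ, P.IsHomogeneous n →
      (polyLaplacian d ^ k) P = 0 →
      P ∈ Submodule.span ℝ {Q : MvPolynomial (Fin d) ℝ | ∃ j m Y, 2 * j + m = n ∧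
        IsSolidHarmonic m Y ∧ Q = polyNormSq d ^ j * Y} from
    H (n + 1) P hP (polyLaplacian_pow_eq_zero (by omega) hP)
  intro k
  induction k with
  | zero =>
    intro P _ h
    have : P = 0 := by simpa using h
    rw [this]; exact Submodule.zero_mem _
  | succ k ih =>
    intro P hP h
    by_cases hk : n < 2 * k
    · exact ih P hP (polyLaplacian_pow_eq_zero hk hP)
    -- `Y` is harmonic since `Δ^(k+1) P = 0`. As `Δ^k (‖x‖^(2k) Y) = c Y` with `c > 0`, subtracting
    -- `c⁻¹ ‖x‖^(2k) Y` leaves a polynomial killed by `Δ^k`.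
    set Y := (polyLaplacian d ^ k) P with hYdef
    have hY : IsSolidHarmonic (n - 2 * k) Y := by
      refine ⟨isHomogeneous_polyLaplacian_pow hP k, ?_⟩
      rw [← polyLaplacian_apply, hYdef, ← Module.End.mul_apply, ← pow_succ', h]
    obtain ⟨c, hc, hcY⟩ := polyLaplacian_iterate_pow_mul hd hY k
    have hdeg : 2 * k + (n - 2 * k) = n := by omega
    have hmem : c⁻¹ • (polyNormSq d ^ k * Y) ∈
        Submodule.span ℝ {Q : MvPolynomial (Fin d) ℝ | ∃ j m Y, 2 * j + m = n ∧
        IsSolidHarmonic m Y ∧ Q = polyNormSq d ^ j * Y} :=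
      Submodule.smul_mem _ _ (Submodule.subset_span ⟨k, _, Y, hdeg, hY, rfl⟩)
    have hhom : (c⁻¹ • (polyNormSq d ^ k * Y)).IsHomogeneous n := by
      have := hY.isHomogeneous_mul k
      rw [hdeg] at this
      exact (homogeneousSubmodule (Fin d) ℝ n).smul_mem _ this
    have h0 := ih (P - c⁻¹ • (polyNormSq d ^ k * Y)) (hP.sub hhom) (by
      rw [map_sub, map_smul, hcY, smul_smul, inv_mul_cancel₀ hc.ne', one_smul, sub_self])
    simpa using Submodule.add_mem _ h0 hmem

theorem eval_polyNormSq (x : EuclideanSpace ℝ (Fin d)) :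
    eval (fun i => x i) (polyNormSq d) = ‖x‖ ^ 2 := by
  simp [polyNormSq, EuclideanSpace.norm_sq_eq]

/-- The function `t^k Y(x)` on the conic surface. -/
def coneHarmonic (k : ℕ) (Y : MvPolynomial (Fin d) ℝ) (p : ConeSurface d) : ℝ :=
  p.1.2 ^ k * eval (fun i => p.1.1 i) Y

/-- The functions `t^k Y(x)` on the conic surface, `Y` a solid harmonic, of degree at most `n`. -/
def coneHarmonics (d n : ℕ) : Set (ConeSurface d → ℝ) :=
  {q | ∃ k m Y, k + m ≤ n ∧ IsSolidHarmonic m Y ∧ q = coneHarmonic k Y}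

/-- The polynomials of degree at most `n` on the conic surface, as a vector space. -/
def conePolys (d n : ℕ) : Submodule ℝ (ConeSurface d → ℝ) :=
  (restrictTotalDegree (Fin d ⊕ Unit) ℝ n).map
    (LinearMap.pi fun p : ConeSurface d =>
      (aeval (R := ℝ) (Sum.elim (fun i => p.1.1 i) (fun _ => p.1.2))).toLinearMap)

theorem mem_conePolys {n : ℕ} {q : ConeSurface d → ℝ} : q ∈ conePolys d n ↔ IsConePoly n q := by
  simp only [conePolys, Submodule.mem_map, mem_restrictTotalDegree, IsConePoly]
  refine exists_congr fun P => and_congr_right fun _ => ?_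
  rw [funext_iff]
  refine forall_congr' fun p => ?_
  rw [eq_comm]
  simp [aeval_eq_eval]

instance (n : ℕ) : Module.Finite ℝ (conePolys d n) :=
  inferInstanceAs (Module.Finite ℝ ((restrictTotalDegree (Fin d ⊕ Unit) ℝ n).map _))

theorem eval_polyNormSq_pow_mul (p : ConeSurface d) (j : ℕ) (Y : MvPolynomial (Fin d) ℝ) :
    eval (fun i => p.1.1 i) (polyNormSq d ^ j * Y) = coneHarmonic (2 * j) Y p := by
  rw [map_mul, map_pow, eval_polyNormSq, p.2.1, coneHarmonic, pow_mul]

/-- On the cone the factor `‖x‖^(2j)` of the Fischer decomposition becomes `t^(2j)`, which joins the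
power of `t`. -/
theorem coneHarmonic_mem_span (hd : 1 ≤ d) {n k l : ℕ} {P : MvPolynomial (Fin d) ℝ}
    (hP : P.IsHomogeneous l) (hkl : k + l ≤ n) :
    coneHarmonic k P ∈ Submodule.span ℝ (coneHarmonics d n) := by
  let L : MvPolynomial (Fin d) ℝ →ₗ[ℝ] (ConeSurface d → ℝ) :=
    LinearMap.pi fun p => (p.1.2 ^ k) • (aeval (R := ℝ) (fun i => p.1.1 i)).toLinearMap
  have hL : ∀ Q, L Q = coneHarmonic k Q := by
    intro Q; funext p; simp [L, coneHarmonic, aeval_eq_eval]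
  rw [← hL]
  have h := Submodule.mem_map_of_mem (f := L) (mem_span_fischer hd hP)
  rw [Submodule.map_span] at h
  refine Submodule.span_mono ?_ h
  rintro _ ⟨_, ⟨j, m, Y, hjm, hY, rfl⟩, rfl⟩
  refine ⟨k + 2 * j, m, Y, by omega, hY, ?_⟩
  rw [hL]
  funext p
  rw [coneHarmonic, eval_polyNormSq_pow_mul, coneHarmonic, coneHarmonic, pow_add, mul_assoc]

/-- This reduces every linear statement about polynomials to the functions `t^k Y(x)`, on which
`∂_t` only sees `t^k`. -/
theorem conePolys_eq_span (hd : 1 ≤ d) (n : ℕ) :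
    conePolys d n = Submodule.span ℝ (coneHarmonics d n) := by
  apply le_antisymm
  · rintro q hq
    obtain ⟨P, hP, hq⟩ := mem_conePolys.1 hq
    -- Each monomial of `P` splits into a power of `t` and a monomial in `x`.
    have : q = ∑ a ∈ P.support, P.coeff a • coneHarmonic (a (Sum.inr ()))
        (monomial (a.comapDomain Sum.inl Sum.inl_injective.injOn) 1) := by
      funext p
      rw [hq p, eval_eq, Finset.sum_apply]
      refine Finset.sum_congr rfl fun a _ => ?_
      simp only [coneHarmonic, Pi.smul_apply, smul_eq_mul, eval_monomial, one_mul]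
      congr 1
      rw [Finsupp.prod_of_support_subset (s := Finset.univ) _ (Finset.subset_univ _) _ (by simp)]
      rw [Finset.prod_subset (Finset.subset_univ _) (by
        intro i _ hi; simp [Finsupp.notMem_support_iff.1 hi])]
      rw [Fintype.prod_sum_type]
      simp [mul_comm]
    rw [this]
    refine Submodule.sum_mem _ fun a ha => Submodule.smul_mem _ _ ?_
    refine coneHarmonic_mem_span hd (isHomogeneous_monomial _ rfl) ?_
    refine le_trans ?_ ((le_totalDegree ha).trans hP)
    rw [Finsupp.degree_eq_sum, Finsupp.sum_of_support_subset (s := Finset.univ) _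
      (Finset.subset_univ _) _ (by simp), Fintype.sum_sum_type]
    simp [add_comm]
  · rw [Submodule.span_le]
    rintro _ ⟨k, m, Y, hkm, hY, rfl⟩
    rw [SetLike.mem_coe, mem_conePolys]
    refine ⟨X (Sum.inr ()) ^ k * rename Sum.inl Y, ?_, fun p => ?_⟩
    · refine (totalDegree_mul _ _).trans (le_trans (add_le_add ?_ ?_) hkm)
      · simp
      · exact (totalDegree_rename_le _ _).trans hY.1.totalDegree_le
    · simp [coneHarmonic, eval_rename, Function.comp_def]

theorem IsConePoly.one_sub_pow_mul {n : ℕ} {q : ConeSurface d → ℝ} (hq : IsConePoly n q) (s : ℕ) :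
    IsConePoly (n + s) (fun p => (1 - p.1.2) ^ s * q p) := by
  obtain ⟨P, hP, h⟩ := hq
  refine ⟨(1 - X (Sum.inr ())) ^ s * P, ?_, fun p => by simp [h p]⟩
  refine (totalDegree_mul _ _).trans ?_
  rw [add_comm]
  refine add_le_add hP ((totalDegree_pow _ _).trans ?_)
  refine (Nat.mul_le_mul_left s ((totalDegree_sub _ _).trans ?_)).trans_eq (mul_one s)
  simp

theorem IsConePoly.mono {n k : ℕ} (hnk : n ≤ k) {q : ConeSurface d → ℝ} (hq : IsConePoly n q) :
    IsConePoly k q := by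
  obtain ⟨P, hP, h⟩ := hq
  exact ⟨P, hP.trans hnk, h⟩

theorem IsConePoly.continuous {n : ℕ} {q : ConeSurface d → ℝ} (hq : IsConePoly n q) :
    Continuous q := by
  obtain ⟨P, -, h⟩ := hq
  rw [funext h]
  refine (MvPolynomial.continuous_eval P).comp (continuous_pi ?_)
  rintro (i | i)
  · simp only [Sum.elim_inl]; fun_prop
  · simp only [Sum.elim_inr]; fun_prop

end Fischer

/-! ### Solid harmonics on the sphere: orthogonality and completeness -/

section Sphere

open MvPolynomial

variable {d : ℕ}

instance : IsFiniteMeasure (sphereMeasure d) :=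
  inferInstanceAs (IsFiniteMeasure (volume : Measure (EuclideanSpace ℝ (Fin d))).toSphere)

instance : (sphereMeasure d).IsOpenPosMeasure :=
  inferInstanceAs (volume : Measure (EuclideanSpace ℝ (Fin d))).toSphere.IsOpenPosMeasure

theorem nontrivial_euclideanSpace (hd : 1 ≤ d) : Nontrivial (EuclideanSpace ℝ (Fin d)) := by
  have : Nonempty (Fin d) := ⟨⟨0, hd⟩⟩
  infer_instance

theorem sphereArea_pos (hd : 1 ≤ d) : 0 < sphereArea d := by
  have := nontrivial_euclideanSpace hd
  have : NeZero (sphereMeasure d) :=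
    ⟨Measure.toSphere_ne_zero (volume : Measure (EuclideanSpace ℝ (Fin d)))⟩
  exact measureReal_univ_pos

/-- The restriction of a polynomial to the unit sphere. -/
def sphereEval (Y : MvPolynomial (Fin d) ℝ) (ξ : UnitSphere d) : ℝ :=
  eval (fun i => (ξ : EuclideanSpace ℝ (Fin d)) i) Y

@[fun_prop]
theorem continuous_sphereEval (Y : MvPolynomial (Fin d) ℝ) : Continuous (sphereEval Y) :=
  (MvPolynomial.continuous_eval Y).comp (continuous_pi fun i => by fun_prop)

theorem continuous_eval_euclidean (Y : MvPolynomial (Fin d) ℝ) :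
    Continuous fun x : EuclideanSpace ℝ (Fin d) => eval (fun i => x i) Y :=
  (MvPolynomial.continuous_eval Y).comp (continuous_pi fun i => by fun_prop)

theorem MvPolynomial.IsHomogeneous.eval_smul' {σ : Type*} [Fintype σ] {n : ℕ}
    {P : MvPolynomial σ ℝ} (hP : P.IsHomogeneous n) (r : ℝ) (x : σ → ℝ) :
    eval (fun i => r * x i) P = r ^ n * eval x P := by
  rw [eval_eq, eval_eq, Finset.mul_sum]
  refine Finset.sum_congr rfl fun a ha => ?_
  have hdeg : ∑ i ∈ a.support, a i = n := by
    have := hP (mem_support_iff.1 ha)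
    rwa [Finsupp.weight_apply, Finsupp.sum, Finset.sum_congr rfl] at this
    intros; simp
  simp only [mul_pow, Finset.prod_mul_distrib, Finset.prod_pow_eq_pow_sum, hdeg]
  ring

/-- Integration in polar coordinates of a function with separated variables. -/
theorem integral_polar (q : UnitSphere d → ℝ) (h : ℝ → ℝ)
    (F : EuclideanSpace ℝ (Fin d) → ℝ) (hd : 1 ≤ d)
    (hF : ∀ r : ℝ, 0 < r → ∀ ξ : UnitSphere d, F (r • (ξ : EuclideanSpace ℝ (Fin d))) = h r * q ξ) :
    ∫ x, F x = (∫ ξ, q ξ ∂(sphereMeasure d)) *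
      ∫ r : Set.Ioi (0 : ℝ), h r ∂(Measure.volumeIoiPow (d - 1)) := by
  have := nontrivial_euclideanSpace hd
  set μ : Measure (EuclideanSpace ℝ (Fin d)) := volume
  have hμ := μ.measurePreserving_homeomorphUnitSphereProd
  rw [finrank_euclideanSpace_fin] at hμ
  calc ∫ x, F x = ∫ x : ({(0)}ᶜ : Set (EuclideanSpace ℝ (Fin d))), F x.1 ∂(μ.comap (↑)) := by
        rw [integral_subtype_comap (measurableSet_singleton _).compl F,
          restrict_compl_singleton]
    _ = ∫ z : UnitSphere d × Set.Ioi (0 : ℝ), q z.1 * h z.2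
          ∂(μ.toSphere.prod (.volumeIoiPow (d - 1))) := by
        rw [← hμ.integral_comp (Homeomorph.measurableEmbedding _)]
        refine integral_congr_ae (.of_forall fun x => ?_)
        have := hF _ (homeomorphUnitSphereProd (EuclideanSpace ℝ (Fin d)) x).2.2
          (homeomorphUnitSphereProd (EuclideanSpace ℝ (Fin d)) x).1
        simp only
        rw [mul_comm, ← this]
        have hx0 : ‖(x : EuclideanSpace ℝ (Fin d))‖ ≠ 0 := norm_ne_zero_iff.2 x.2
        simp [smul_smul, hx0]
    _ = _ := integral_prod_mul q (fun r : Set.Ioi (0 : ℝ) => h r)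

theorem hasLineDerivAt_eval (P : MvPolynomial (Fin d) ℝ) (x : EuclideanSpace ℝ (Fin d))
    (i : Fin d) :
    HasLineDerivAt ℝ (fun x : EuclideanSpace ℝ (Fin d) => eval (fun i => x i) P)
      (eval (fun i => x i) (pderiv i P)) x (EuclideanSpace.single i 1) := by
  unfold HasLineDerivAt
  induction P using MvPolynomial.induction_on with
  | C a => simpa using hasDerivAt_const (0 : ℝ) a
  | add p q hp hq => simpa using hp.fun_add hq
  | mul_X p j hp =>
    have hj : HasDerivAt (fun t : ℝ => (x + t • EuclideanSpace.single i (1 : ℝ)) j)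
        (if j = i then 1 else 0) 0 := by
      simp only [PiLp.add_apply, PiLp.smul_apply, PiLp.single_apply, smul_eq_mul]
      simpa using ((hasDerivAt_id (0 : ℝ)).mul_const (if j = i then (1 : ℝ) else 0)).const_add (x j)
    have := hp.mul hj
    simp only [map_mul, eval_X, pderiv_mul, map_add, pderiv_X, Pi.single_apply]
    refine this.congr_deriv ?_
    by_cases h : j = i <;> simp [h]

theorem hasDerivAt_sq_max (s : ℝ) :
    HasDerivAt (fun s : ℝ => (max 0 (1 - s)) ^ 2) (-2 * max 0 (1 - s)) s := by
  have hsub : HasDerivAt (fun s : ℝ => (1 - s) ^ 2) (-2 * (1 - s)) s := by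
    have := ((hasDerivAt_id s).const_sub 1).pow 2
    refine this.congr_deriv ?_
    simp
  rcases lt_trichotomy s 1 with h | h | h
  · rw [max_eq_right (by linarith)]
    refine hsub.congr_of_eventuallyEq ?_
    filter_upwards [Iio_mem_nhds h] with y hy
    rw [max_eq_right (by linarith [Set.mem_Iio.1 hy])]
  · subst h
    -- At the corner the squared positive part is dominated by `(1-s)²`, which has derivative zero
    -- there.
    rw [hasDerivAt_iff_isLittleO] at hsub ⊢
    simp only [sub_self, max_self, mul_zero, smul_zero, sub_zero] at hsub ⊢
    refine Asymptotics.IsBigO.trans_isLittleO (Asymptotics.IsBigO.of_bound 1 ?_) hsub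
    filter_upwards with y
    have : |max 0 (1 - y)| ≤ |1 - y| := by
      rcases le_total 0 (1 - y) with h | h
      · rw [max_eq_right h]
      · rw [max_eq_left h, abs_zero]; exact abs_nonneg _
    simpa [one_mul] using sq_le_sq.2 this
  · rw [max_eq_left (by linarith), mul_zero]
    refine (hasDerivAt_const s (0 : ℝ)).congr_of_eventuallyEq ?_
    filter_upwards [Ioi_mem_nhds h] with y hy
    rw [max_eq_left (by linarith [Set.mem_Ioi.1 hy])]
    simp

theorem integrable_max_mul_eval (k : ℕ) (hk : k ≠ 0) (P : MvPolynomial (Fin d) ℝ) :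
    Integrable fun x : EuclideanSpace ℝ (Fin d) =>
      (max 0 (1 - ‖x‖ ^ 2)) ^ k * eval (fun i => x i) P := by
  refine Continuous.integrable_of_hasCompactSupport ?_ ?_
  · have := continuous_eval_euclidean P
    fun_prop
  · refine HasCompactSupport.intro (isCompact_closedBall 0 1) fun x hx => ?_
    have hx : 1 < ‖x‖ := by simpa using hx
    rw [max_eq_left (by nlinarith), zero_pow hk, zero_mul]

/-- Integration by parts against the compactly supported `C¹` cutoff `(1-‖x‖²)_+²`, which has no
boundary terms. This stands in for the divergence theorem on the ball. -/
theorem integral_max_mul_pderiv (P : MvPolynomial (Fin d) ℝ) (i : Fin d) :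
    ∫ x : EuclideanSpace ℝ (Fin d), (max 0 (1 - ‖x‖ ^ 2)) ^ 2 * eval (fun i => x i) (pderiv i P) =
      4 * ∫ x : EuclideanSpace ℝ (Fin d),
        (max 0 (1 - ‖x‖ ^ 2)) ^ 1 * eval (fun i => x i) (X i * P) := by
  have hderiv : ∀ x : EuclideanSpace ℝ (Fin d), HasLineDerivAt ℝ
      (fun x : EuclideanSpace ℝ (Fin d) => (max 0 (1 - ‖x‖ ^ 2)) ^ 2)
      (-4 * ((max 0 (1 - ‖x‖ ^ 2)) ^ 1 * x i)) x (EuclideanSpace.single i 1) := by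
    intro x
    have h1 := hasLineDerivAt_eval (polyNormSq d) x i
    unfold HasLineDerivAt at h1 ⊢
    simp only [eval_polyNormSq, pderiv_polyNormSq] at h1
    have h0 : ‖x‖ ^ 2 = ‖x + (0 : ℝ) • EuclideanSpace.single i (1 : ℝ)‖ ^ 2 := by simp
    have h2 := hasDerivAt_sq_max (‖x‖ ^ 2)
    rw [h0] at h2
    refine (HasDerivAt.comp (0 : ℝ) h2 h1).congr_deriv ?_
    rw [← h0]
    simp
    ring
  have hPi := fun k hk => integrable_max_mul_eval k hk P
  have e : ∀ x : EuclideanSpace ℝ (Fin d), (-4 * ((max 0 (1 - ‖x‖ ^ 2)) ^ 1 * x i)) *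
      eval (fun i => x i) P =
      -4 * ((max 0 (1 - ‖x‖ ^ 2)) ^ 1 * eval (fun i => x i) (X i * P)) := by
    intro x; simp; ring
  have h := integral_bilinear_hasLineDerivAt_right_eq_neg_left_of_integrable
    (μ := (volume : Measure (EuclideanSpace ℝ (Fin d))))
    (B := ContinuousLinearMap.mul ℝ ℝ)
    (f := fun x : EuclideanSpace ℝ (Fin d) => (max 0 (1 - ‖x‖ ^ 2)) ^ 2)
    (f' := fun x => -4 * ((max 0 (1 - ‖x‖ ^ 2)) ^ 1 * x i))
    (g := fun x : EuclideanSpace ℝ (Fin d) => eval (fun i => x i) P)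
    (g' := fun x => eval (fun i => x i) (pderiv i P)) (v := EuclideanSpace.single i 1)
    (by
      simp only [ContinuousLinearMap.mul_apply', e]
      exact (integrable_max_mul_eval 1 one_ne_zero _).const_mul _)
    (integrable_max_mul_eval 2 two_ne_zero _) (integrable_max_mul_eval 2 two_ne_zero _)
    (fun x _ => hderiv x) (fun x _ => hasLineDerivAt_eval P x i)
  simp only [ContinuousLinearMap.mul_apply', e] at h
  rw [h, integral_const_mul]
  ring

/-- In polar coordinates `c` is the radial integral of `(1-r²)_+ r^N`, the same for all `P` of
degree `N`. -/
theorem integral_max_mul_homogeneous (hd : 1 ≤ d) (N : ℕ) :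
    ∃ c : ℝ, 0 < c ∧ ∀ P : MvPolynomial (Fin d) ℝ, P.IsHomogeneous N →
      ∫ x : EuclideanSpace ℝ (Fin d), (max 0 (1 - ‖x‖ ^ 2)) ^ 1 * eval (fun i => x i) P =
        c * ∫ ξ, sphereEval P ξ ∂(sphereMeasure d) := by
  have := nontrivial_euclideanSpace hd
  set c := ∫ r : Set.Ioi (0 : ℝ), (max 0 (1 - (r : ℝ) ^ 2)) ^ 1 * (r : ℝ) ^ N
    ∂(Measure.volumeIoiPow (d - 1)) with hc
  refine ⟨c, ?_, fun P hP => ?_⟩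
  -- Positivity of `c`: the polar formula for `(1-‖x‖²)_+ ‖x‖^N`, whose integral is positive, has
  -- `c` as a factor.
  · have h1 := integral_polar (d := d) (fun _ => 1)
      (fun r => (max 0 (1 - r ^ 2)) ^ 1 * r ^ N)
      (fun x => (max 0 (1 - ‖x‖ ^ 2)) ^ 1 * ‖x‖ ^ N) hd (by
        intro r hr ξ
        simp [norm_smul, abs_of_pos hr])
    have h2 : 0 < ∫ x : EuclideanSpace ℝ (Fin d), (max 0 (1 - ‖x‖ ^ 2)) ^ 1 * ‖x‖ ^ N := by
      obtain ⟨ξ⟩ : Nonempty (UnitSphere d) := (NormedSpace.sphere_nonempty.2 zero_le_one).to_subtype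
      refine Continuous.integral_pos_of_hasCompactSupport_nonneg_nonzero
        (x := (1 / 2 : ℝ) • (ξ : EuclideanSpace ℝ (Fin d))) (by fun_prop) ?_ ?_ ?_
      · refine HasCompactSupport.intro (isCompact_closedBall 0 1) fun x hx => ?_
        have hx : 1 < ‖x‖ := by simpa using hx
        rw [max_eq_left (by nlinarith), zero_pow one_ne_zero, zero_mul]
      · intro x
        exact mul_nonneg (pow_nonneg (le_max_left _ _) _) (by positivity)
      · simp only [norm_smul, norm_eq_of_mem_sphere, Real.norm_eq_abs]
        norm_num
    rw [h1] at h2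
    have h3 : (0 : ℝ) ≤ ∫ ξ : UnitSphere d, (1 : ℝ) ∂(sphereMeasure d) :=
      integral_nonneg fun _ => zero_le_one
    exact pos_of_mul_pos_right h2 h3
  · rw [mul_comm]
    refine integral_polar (sphereEval P) (fun r => (max 0 (1 - r ^ 2)) ^ 1 * r ^ N) _ hd ?_
    intro r hr ξ
    simp only [norm_smul, norm_eq_of_mem_sphere, Real.norm_eq_abs, abs_of_pos hr, mul_one,
      PiLp.smul_apply, smul_eq_mul, sphereEval]
    rw [hP.eval_smul' r]
    ring

/-- Solid harmonics of different degrees are orthogonal on the sphere. -/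
theorem integral_sphereEval_mul_eq_zero (hd : 1 ≤ d) {j m : ℕ} (hjm : j ≠ m)
    {Y Z : MvPolynomial (Fin d) ℝ} (hY : IsSolidHarmonic j Y) (hZ : IsSolidHarmonic m Z) :
    ∫ ξ, sphereEval Y ξ * sphereEval Z ξ ∂(sphereMeasure d) = 0 := by
  -- The field of Green's formula: it is divergence free, and by Euler's identity `x · W = (m - j) Y
  -- Z`.
  set W : Fin d → MvPolynomial (Fin d) ℝ := fun i => Y * pderiv i Z - Z * pderiv i Y
  have hdiv : ∑ i, pderiv i (W i) = 0 := by
    have : ∀ i, pderiv i (W i) = Y * pderiv i (pderiv i Z) - Z * pderiv i (pderiv i Y) := by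
      intro i; simp only [W, map_sub, pderiv_mul]; ring
    simp only [this, Finset.sum_sub_distrib, ← Finset.mul_sum, hY.2, hZ.2]
    simp
  have hrad : ∑ i, X i * W i = ((m : ℝ) - j) • (Y * Z) := by
    have : ∀ i, X i * W i = Y * (X i * pderiv i Z) - Z * (X i * pderiv i Y) := by
      intro i; simp only [W]; ring
    simp only [this, Finset.sum_sub_distrib, ← Finset.mul_sum, hY.1.sum_X_mul_pderiv,
      hZ.1.sum_X_mul_pderiv, nsmul_eq_mul, smul_eq_C_mul, map_sub, map_natCast]
    ring
  have h1 : ∫ x : EuclideanSpace ℝ (Fin d),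
      (max 0 (1 - ‖x‖ ^ 2)) ^ 1 * eval (fun i => x i) (∑ i, X i * W i) = 0 := by
    have h2 : ∫ x : EuclideanSpace ℝ (Fin d),
        (max 0 (1 - ‖x‖ ^ 2)) ^ 2 * eval (fun i => x i) (∑ i, pderiv i (W i)) = 0 := by
      simp [hdiv]
    simp only [map_sum (eval _), Finset.mul_sum] at h2 ⊢
    rw [integral_finsetSum _ fun i _ => integrable_max_mul_eval 2 two_ne_zero _] at h2
    rw [integral_finsetSum _ fun i _ => integrable_max_mul_eval 1 one_ne_zero _]
    simp only [integral_max_mul_pderiv, ← Finset.mul_sum] at h2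
    linarith
  obtain ⟨c, hc, h⟩ := integral_max_mul_homogeneous hd (j + m)
  have h3 := h (Y * Z) (hY.1.mul hZ.1)
  rw [hrad] at h1
  simp only [smul_eval, mul_left_comm _ ((m : ℝ) - j), integral_const_mul] at h1
  have h4 : (m : ℝ) - j ≠ 0 := sub_ne_zero.2 (by exact_mod_cast hjm.symm)
  rw [(mul_eq_zero.1 h1).resolve_left h4] at h3
  have h5 := (mul_eq_zero.1 h3.symm).resolve_left hc.ne'
  simpa [sphereEval] using h5

/-- A square integrable function on the sphere that is orthogonal to all monomials vanishes. -/
theorem ae_eq_zero_of_integral_monomial {G : UnitSphere d → ℝ}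
    (hG : MemLp G 2 (sphereMeasure d))
    (h : ∀ a : Fin d →₀ ℕ, ∫ ξ, G ξ * sphereEval (monomial a 1) ξ ∂(sphereMeasure d) = 0) :
    G =ᵐ[sphereMeasure d] 0 := by
  -- Pairing with `G`. It vanishes on polynomials, hence on all continuous functions by
  -- Stone–Weierstrass, and these are dense in `L²`.
  let Λ : C(UnitSphere d, ℝ) →L[ℝ] ℝ :=
    (innerSL ℝ hG.toLp).comp (ContinuousMap.toLp (E := ℝ) 2 (sphereMeasure d) ℝ)
  have hΛ : ∀ φ : C(UnitSphere d, ℝ), Λ φ = ∫ ξ, G ξ * φ ξ ∂(sphereMeasure d) := by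
    intro φ
    simp only [Λ, ContinuousLinearMap.comp_apply, innerSL_apply_apply, L2.inner_def]
    refine integral_congr_ae ?_
    filter_upwards [hG.coeFn_toLp, ContinuousMap.coeFn_toLp (p := 2) (sphereMeasure d) (𝕜 := ℝ) φ]
      with ξ h1 h2
    rw [h1, h2]
    simp [mul_comm]
  let e : MvPolynomial (Fin d) ℝ →ₐ[ℝ] C(UnitSphere d, ℝ) :=
    aeval fun i => ⟨fun ξ => (ξ : EuclideanSpace ℝ (Fin d)) i, by fun_prop⟩
  have he : ∀ P ξ, e P ξ = sphereEval P ξ := by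
    intro P ξ
    induction P using MvPolynomial.induction_on with
    | C a => simp [e, sphereEval]
    | add p q hp hq => simp [hp, hq, sphereEval]
    | mul_X p j hp => simp [hp, e, sphereEval]
  have hpoly : ∀ P, Λ (e P) = 0 := by
    intro P
    induction P using MvPolynomial.induction_on' with
    | monomial a c =>
      have : monomial a c = c • monomial a (1 : ℝ) := by simp [smul_monomial]
      rw [this, map_smul, map_smul, hΛ]
      simp [he, h a]
    | add p q hp hq => rw [map_add, map_add, hp, hq, add_zero]
  have hsep : e.range.SeparatesPoints := by
    intro ξ η hne
    have : ∃ i, (ξ : EuclideanSpace ℝ (Fin d)) i ≠ (η : EuclideanSpace ℝ (Fin d)) i := by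
      by_contra! hcon
      exact hne (Subtype.ext (PiLp.ext hcon))
    obtain ⟨i, hi⟩ := this
    exact ⟨_, ⟨e (X i), ⟨X i, rfl⟩, rfl⟩, by simpa [he, sphereEval] using hi⟩
  have hzero : Λ = 0 := by
    have hcl : (e.range.topologicalClosure : Set C(UnitSphere d, ℝ)) ⊆ {φ | Λ φ = 0} := by
      rw [Subalgebra.topologicalClosure_coe]
      refine closure_minimal ?_ (isClosed_eq Λ.continuous continuous_const)
      rintro _ ⟨P, rfl⟩
      exact hpoly P
    rw [ContinuousMap.subalgebra_topologicalClosure_eq_top_of_separatesPoints _ hsep] at hcl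
    ext φ
    exact hcl (Algebra.mem_top)
  have hd2 := ContinuousMap.toLp_denseRange ℝ (sphereMeasure d) ℝ (p := 2) ENNReal.ofNat_ne_top
  have h0 : innerSL ℝ hG.toLp = 0 := by
    refine DFunLike.coe_injective (hd2.equalizer (innerSL ℝ hG.toLp).continuous
      continuous_const ?_)
    funext φ
    exact DFunLike.congr_fun hzero φ
  have h1 : hG.toLp = 0 := by
    have : inner ℝ hG.toLp hG.toLp = 0 := DFunLike.congr_fun h0 hG.toLp
    exact inner_self_eq_zero.1 this
  filter_upwards [hG.coeFn_toLp, Lp.coeFn_zero ℝ 2 (sphereMeasure d)] with ξ h2 h3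
  rw [← h2, h1, h3]

/-- On the sphere every polynomial agrees with a sum of solid harmonics. -/
theorem exists_sum_solidHarmonic (hd : 1 ≤ d) (a : Fin d →₀ ℕ) :
    sphereEval (monomial a (1 : ℝ)) ∈ Submodule.span ℝ
      {φ : UnitSphere d → ℝ | ∃ m Y, IsSolidHarmonic m Y ∧ φ = sphereEval Y} := by
  let L : MvPolynomial (Fin d) ℝ →ₗ[ℝ] (UnitSphere d → ℝ) :=
    LinearMap.pi fun ξ => (aeval (R := ℝ)
      (fun i => (ξ : EuclideanSpace ℝ (Fin d)) i)).toLinearMap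
  have hL : ∀ Q, L Q = sphereEval Q := by
    intro Q; funext p; simp [L, sphereEval, aeval_eq_eval]
  rw [← hL]
  have h := Submodule.mem_map_of_mem (f := L)
    (mem_span_fischer hd (isHomogeneous_monomial (1 : ℝ) (d := a) rfl))
  rw [Submodule.map_span] at h
  refine Submodule.span_mono ?_ h
  rintro _ ⟨_, ⟨j, m, Y, hjm, hY, rfl⟩, rfl⟩
  refine ⟨m, Y, hY, ?_⟩
  rw [hL]
  funext ξ
  simp [sphereEval, eval_polyNormSq]

end Sphere

/-! ### One-variable calculus: vanishing at the rim and repeated integration by parts -/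

section AbsolutelyContinuousChains

/-- A sequence of functions on `(0, 1]`, each of which is locally absolutely continuous with
derivative the next one. -/
def IsACChain (s : ℕ) (φ : ℕ → ℝ → ℝ) : Prop :=
  ∀ k < s, ∀ t ∈ Set.Ioc (0 : ℝ) 1, IntervalIntegrable (φ (k + 1)) volume t 1 ∧
    φ k 1 - φ k t = ∫ v in t..1, φ (k + 1) v

theorem IsACChain.tail {s : ℕ} {φ : ℕ → ℝ → ℝ} (h : IsACChain (s + 1) φ) :
    IsACChain s (fun k => φ (k + 1)) :=
  fun k hk => h (k + 1) (by omega)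

theorem IsACChain.continuousOn {s : ℕ} {φ : ℕ → ℝ → ℝ} (h : IsACChain s φ) {k : ℕ} (hk : k < s) :
    ContinuousOn (φ k) (Set.Ioc 0 1) := by
  intro t ht
  have ht2 : t / 2 ∈ Set.Ioc (0 : ℝ) 1 := ⟨by linarith [ht.1], by linarith [ht.1, ht.2]⟩
  have hle : t / 2 ≤ 1 := ht2.2
  have hc : ContinuousOn (fun u => ∫ v in u..1, φ (k + 1) v) (Set.Icc (t / 2) 1) := by
    have := intervalIntegral.continuousOn_primitive_interval_left (a := t / 2) (b := 1)
      (f := φ (k + 1)) (μ := volume) (by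
        rw [Set.uIcc_of_le hle, ← intervalIntegrable_iff_integrableOn_Icc_of_le hle]
        exact (h k hk _ ht2).1)
    rwa [Set.uIcc_of_le hle] at this
  have hc2 : ContinuousOn (φ k) (Set.Icc (t / 2) 1) := by
    refine (continuousOn_const (c := φ k 1)).sub hc |>.congr fun u hu => ?_
    have := (h k hk u ⟨by linarith [hu.1, ht.1], hu.2⟩).2
    simp only [Pi.sub_apply]
    linarith
  refine (hc2 t ⟨by linarith [ht.1], ht.2⟩).mono_of_mem_nhdsWithin ?_
  have : Set.Ioi (t / 2) ∈ 𝓝 t := Ioi_mem_nhds (by linarith [ht.1])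
  filter_upwards [mem_nhdsWithin_of_mem_nhds this, self_mem_nhdsWithin] with u hu hu'
  exact ⟨le_of_lt hu, hu'.2⟩

/-- Lebesgue differentiation on intervals `(1/(n+2), 1)` exhausting `(0, 1)`; integrability near `0`
is not available. -/
theorem ae_eq_zero_of_integral_eq_zero {ψ : ℝ → ℝ}
    (h : ∀ t ∈ Set.Ioc (0 : ℝ) 1, IntervalIntegrable ψ volume t 1 ∧ ∫ v in t..1, ψ v = 0) :
    ∀ᵐ t ∂(volume.restrict (Set.Ioc (0 : ℝ) 1)), ψ t = 0 := by
  have key : ∀ n : ℕ, ∀ᵐ x : ℝ, x ∈ Set.Ioo (1 / ((n : ℝ) + 2)) 1 → ψ x = 0 := by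
    intro n
    set a : ℝ := 1 / ((n : ℝ) + 2) with ha
    have ha0 : 0 < a := by positivity
    have ha1 : a ≤ 1 := by
      rw [ha, div_le_one (by positivity)]; linarith [(Nat.cast_nonneg n : (0 : ℝ) ≤ n)]
    have hI := (h a ⟨ha0, ha1⟩).1
    filter_upwards [hI.ae_hasDerivAt_integral] with x hx hxI
    have h1 := hx (by rw [Set.uIcc_of_le ha1]; exact ⟨hxI.1.le, hxI.2.le⟩) 1 (by simp)
    have h2 : HasDerivAt (fun u => ∫ v in (1 : ℝ)..u, ψ v) 0 x := by
      refine (hasDerivAt_const x (0 : ℝ)).congr_of_eventuallyEq ?_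
      filter_upwards [Ioo_mem_nhds hxI.1 hxI.2] with u hu
      rw [intervalIntegral.integral_symm, (h u ⟨ha0.trans hu.1, hu.2.le⟩).2, neg_zero]
    exact h1.unique h2
  rw [ae_restrict_iff' measurableSet_Ioc]
  have h1 : ∀ᵐ x : ℝ, x ≠ 1 := by simp [ae_iff]
  filter_upwards [ae_all_iff.2 key, h1] with x hx hx1 hxI
  obtain ⟨n, hn⟩ := exists_nat_gt (1 / x)
  refine hx n ⟨?_, lt_of_le_of_ne hxI.2 hx1⟩
  rw [div_lt_comm₀ (by positivity) hxI.1]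
  linarith

/-- Each derivative of zero is zero almost everywhere, hence everywhere for `k < s` by continuity.
Applied to the difference of two chains, this yields uniqueness of derivatives. -/
theorem IsACChain.eq_zero_of_zero {s : ℕ} {φ : ℕ → ℝ → ℝ} (h : IsACChain s φ) (hs : 1 ≤ s)
    (h0 : ∀ t ∈ Set.Ioc (0 : ℝ) 1, φ 0 t = 0) :
    (∀ k < s, ∀ t ∈ Set.Ioc (0 : ℝ) 1, φ k t = 0) ∧
      ∀ᵐ t ∂(volume.restrict (Set.Ioc (0 : ℝ) 1)), φ s t = 0 := by
  have hstep : ∀ k < s, (∀ t ∈ Set.Ioc (0 : ℝ) 1, φ k t = 0) →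
      ∀ᵐ t ∂(volume.restrict (Set.Ioc (0 : ℝ) 1)), φ (k + 1) t = 0 := by
    intro k hk hz
    refine ae_eq_zero_of_integral_eq_zero fun t ht => ⟨(h k hk t ht).1, ?_⟩
    rw [← (h k hk t ht).2, hz t ht, hz 1 ⟨one_pos, le_rfl⟩, sub_zero]
  have hall : ∀ k < s, ∀ t ∈ Set.Ioc (0 : ℝ) 1, φ k t = 0 := by
    intro k
    induction k with
    | zero => exact fun _ => h0
    | succ k ih =>
      intro hk
      exact Measure.eqOn_Ioc_of_ae_eq (μ := volume) (g := fun _ => (0 : ℝ))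
        (hstep k (by omega) (ih (by omega))) (h.continuousOn hk) continuousOn_const
  refine ⟨hall, ?_⟩
  have := hstep (s - 1) (by omega) (hall (s - 1) (by omega))
  rwa [Nat.sub_add_cancel hs] at this

/-- Integrate back from the rim. This is the one-variable core of the definiteness of the Sobolev
inner product. -/
theorem IsACChain.eq_zero_of_top {s : ℕ} {φ : ℕ → ℝ → ℝ} (h : IsACChain s φ) (hs : 1 ≤ s)
    (h1 : ∀ k < s, φ k 1 = 0)
    (htop : ∀ᵐ t ∂(volume.restrict (Set.Ioc (0 : ℝ) 1)), φ s t = 0) :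
    ∀ t ∈ Set.Ioc (0 : ℝ) 1, φ 0 t = 0 := by
  have hall : ∀ k ≤ s, ∀ᵐ t ∂(volume.restrict (Set.Ioc (0 : ℝ) 1)), φ (s - k) t = 0 := by
    intro k
    induction k with
    | zero => exact fun _ => htop
    | succ k ih =>
      intro hk
      filter_upwards [ae_restrict_mem measurableSet_Ioc] with t ht
      have h2 := (h (s - (k + 1)) (by omega) t ht).2
      rw [h1 _ (by omega), show s - (k + 1) + 1 = s - k by omega,
        intervalIntegral.integral_zero_ae] at h2
      · linarith
      · have h3 := ih (by omega)
        rw [ae_restrict_iff' measurableSet_Ioc] at h3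
        filter_upwards [h3] with v hv hvI
        rw [Set.uIoc_of_le ht.2] at hvI
        exact hv ⟨ht.1.trans hvI.1, hvI.2⟩
  have := hall s le_rfl
  rw [Nat.sub_self] at this
  exact Measure.eqOn_Ioc_of_ae_eq (μ := volume) (g := fun _ => (0 : ℝ)) this
    (h.continuousOn (by omega)) continuousOn_const

/-- The strict bound makes `φ (k + 1)` continuous, so the derivative exists at every interior point,
as L'Hôpital's rule requires. -/
theorem IsACChain.hasDerivAt {s : ℕ} {φ : ℕ → ℝ → ℝ} (h : IsACChain s φ) {k : ℕ}
    (hk : k + 1 < s) {t : ℝ} (ht : t ∈ Set.Ioo (0 : ℝ) 1) : HasDerivAt (φ k) (φ (k + 1) t) t := by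
  have ht' : t ∈ Set.Ioc (0 : ℝ) 1 := ⟨ht.1, ht.2.le⟩
  have hc : ContinuousAt (φ (k + 1)) t :=
    (h.continuousOn hk).continuousAt (mem_nhds_iff.2
      ⟨Set.Ioo 0 1, Set.Ioo_subset_Ioc_self, isOpen_Ioo, ht⟩)
  have hm : StronglyMeasurableAtFilter (φ (k + 1)) (𝓝 t) :=
    ((h.continuousOn hk).mono Set.Ioo_subset_Ioc_self).stronglyMeasurableAtFilter isOpen_Ioo t ht
  have hd := intervalIntegral.integral_hasDerivAt_left (h k (by omega) t ht').1 hm hc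
  refine (hd.const_sub (φ k 1)).congr_of_eventuallyEq ?_ |>.congr_deriv (by simp)
  filter_upwards [Ioo_mem_nhds ht.1 ht.2] with u hu
  have := (h k (by omega) u ⟨hu.1, hu.2.le⟩).2
  linarith

/-- Iterated L'Hôpital, which gives `c = (-1)^k / k!`. -/
theorem IsACChain.tendsto_div_pow (k : ℕ) : ∀ {s : ℕ} {φ : ℕ → ℝ → ℝ}, IsACChain s φ → k < s →
    (∀ j < k, φ j 1 = 0) →
    ∃ c : ℝ, c ≠ 0 ∧ Tendsto (fun t => φ 0 t / (1 - t) ^ k) (𝓝[<] 1) (𝓝 (c * φ k 1)) := by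
  have hleft : ∀ {s : ℕ} {φ : ℕ → ℝ → ℝ}, IsACChain s φ → 0 < s →
      Tendsto (φ 0) (𝓝[<] 1) (𝓝 (φ 0 1)) := by
    intro s φ h hs
    have := h.continuousOn hs 1 ⟨one_pos, le_rfl⟩
    refine (this.mono_of_mem_nhdsWithin ?_ : ContinuousWithinAt (φ 0) (Set.Iio 1) 1)
    filter_upwards [mem_nhdsWithin_of_mem_nhds (Ioi_mem_nhds one_pos), self_mem_nhdsWithin]
      with t h1 h2
    exact ⟨h1, (Set.mem_Iio.1 h2).le⟩
  induction k with
  | zero =>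
    intro s φ h hs _
    exact ⟨1, one_ne_zero, by simpa using hleft h hs⟩
  | succ k ih =>
    intro s φ h hs hz
    obtain ⟨s, rfl⟩ : ∃ s', s = s' + 1 := ⟨s - 1, by omega⟩
    obtain ⟨c, hc, hlim⟩ := ih h.tail (by omega) fun j hj => hz (j + 1) (by omega)
    have hk : (k : ℝ) + 1 ≠ 0 := by positivity
    refine ⟨-(1 / (k + 1)) * c, mul_ne_zero (neg_ne_zero.2 (one_div_ne_zero hk)) hc, ?_⟩
    have hIoo : ∀ᶠ t : ℝ in 𝓝[<] 1, t ∈ Set.Ioo (0 : ℝ) 1 := by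
      filter_upwards [mem_nhdsWithin_of_mem_nhds (Ioi_mem_nhds one_pos), self_mem_nhdsWithin]
        with t h1 h2
      exact ⟨h1, h2⟩
    refine HasDerivAt.lhopital_zero_nhdsLT (f' := φ 1)
      (g' := fun t => -((k : ℝ) + 1) * (1 - t) ^ k) ?_ ?_ ?_ ?_ ?_ ?_
    · filter_upwards [hIoo] with t ht using h.hasDerivAt (by omega) ht
    · filter_upwards with t
      have := ((hasDerivAt_id t).const_sub 1).pow (k + 1)
      refine this.congr_deriv ?_
      simp
      ring
    · filter_upwards [hIoo] with t ht
      exact mul_ne_zero (neg_ne_zero.2 hk) (pow_ne_zero _ (by linarith [ht.2]))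
    · have := hleft h (by omega)
      rwa [hz 0 (by omega)] at this
    · have : Tendsto (fun t : ℝ => (1 - t) ^ (k + 1)) (𝓝 1) (𝓝 ((1 - 1) ^ (k + 1))) :=
        (tendsto_const_nhds.sub tendsto_id).pow _
      simpa using this.mono_left nhdsWithin_le_nhds
    · have := hlim.const_mul (-(1 / ((k : ℝ) + 1)))
      rw [← mul_assoc] at this
      refine this.congr fun t => ?_
      simp only [zero_add]
      rw [neg_mul, neg_mul, div_neg, one_div, ← div_eq_inv_mul, div_div, mul_comm ((k : ℝ) + 1)]

/-- Once the lower derivatives vanish at `1`, the quotient by `(1-t)^k` tends to a nonzero multiple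
of `φ k 1`; it also tends to `0`, being the given quotient times `(1-t)^(s-1-k)`. -/
theorem IsACChain.eq_zero_of_rim {s : ℕ} {φ : ℕ → ℝ → ℝ} (h : IsACChain s φ)
    (hlim : Tendsto (fun t => φ 0 t / (1 - t) ^ (s - 1)) (𝓝[<] 1) (𝓝 0)) :
    ∀ k < s, φ k 1 = 0 := by
  intro k
  induction k using Nat.strong_induction_on with
  | _ k ih =>
    intro hk
    obtain ⟨c, hc, h1⟩ := h.tendsto_div_pow k hk fun j hj => ih j hj (by omega)
    have h2 : Tendsto (fun t => φ 0 t / (1 - t) ^ (s - 1) * (1 - t) ^ (s - 1 - k)) (𝓝[<] 1)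
        (𝓝 (0 * (1 - 1) ^ (s - 1 - k))) := by
      refine hlim.mul (Tendsto.mono_left ?_ nhdsWithin_le_nhds)
      exact (tendsto_const_nhds.sub tendsto_id).pow _
    rw [zero_mul] at h2
    have h3 := h2.congr' (f₂ := fun t => φ 0 t / (1 - t) ^ k) (by
      filter_upwards [self_mem_nhdsWithin] with t ht
      have h4 : (1 - t) ≠ 0 := by linarith [Set.mem_Iio.1 ht]
      rw [show s - 1 = (s - 1 - k) + k by omega, pow_add]
      have : s - 1 - k + k - k = s - 1 - k := by omega
      rw [this]
      field_simp)
    exact (mul_eq_zero.1 (tendsto_nhds_unique h1 h3)).resolve_left hc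

theorem integral_rpow_Ioo {a : ℝ} (ha : -1 < a) {v : ℝ} (hv : 0 < v) :
    IntegrableOn (fun t : ℝ => t ^ a) (Set.Ioo 0 v) ∧
      ∫ t in Set.Ioo 0 v, t ^ a = v ^ (a + 1) / (a + 1) := by
  constructor
  · rw [← integrableOn_Ioc_iff_integrableOn_Ioo,
      ← intervalIntegrable_iff_integrableOn_Ioc_of_le hv.le]
    exact intervalIntegral.intervalIntegrable_rpow' ha
  · rw [← integral_Ioc_eq_integral_Ioo, ← intervalIntegral.integral_of_le hv.le,
      integral_rpow (Or.inl ha), Real.zero_rpow (by linarith), sub_zero]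

/-- Fubini on the triangle `t < v`, with `∫_0^v t^a dt = v^(a+1)/(a+1)`. Compared with a direct
integration by parts, this needs no boundary value at `0` and yields the integrability of `φ t^a`.
-/
theorem integral_primitive_mul_rpow {a : ℝ} (ha : -1 < a) {φ ψ : ℝ → ℝ}
    (hψ : IntegrableOn (fun v => ψ v * v ^ (a + 1)) (Set.Ioc 0 1))
    (hφ : ∀ t ∈ Set.Ioc (0 : ℝ) 1, φ t = -∫ v in t..1, ψ v) :
    IntegrableOn (fun t => φ t * t ^ a) (Set.Ioc 0 1) ∧
      ∫ t in Set.Ioc 0 1, φ t * t ^ a =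
        -(1 / (a + 1)) * ∫ v in Set.Ioc 0 1, ψ v * v ^ (a + 1) := by
  set μ : Measure ℝ := volume.restrict (Set.Ioc 0 1) with hμ
  have ha1 : 0 < a + 1 := by linarith
  let K : ℝ × ℝ → ℝ := {p : ℝ × ℝ | p.1 < p.2}.indicator fun p => p.1 ^ a * ψ p.2
  have hS : MeasurableSet {p : ℝ × ℝ | p.1 < p.2} := measurableSet_lt measurable_fst measurable_snd
  -- Measurability of `ψ` is recovered by dividing out the positive power of `v`.
  have hψm : AEStronglyMeasurable ψ μ := by
    have h1 : AEStronglyMeasurable (fun v : ℝ => (ψ v * v ^ (a + 1)) * v ^ (-(a + 1))) μ :=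
      hψ.aestronglyMeasurable.mul (by fun_prop)
    refine h1.congr ?_
    filter_upwards [ae_restrict_mem measurableSet_Ioc] with v hv
    rw [mul_assoc, ← Real.rpow_add hv.1, add_neg_cancel, Real.rpow_zero, mul_one]
  have hKm : AEStronglyMeasurable K (μ.prod μ) := by
    refine AEStronglyMeasurable.indicator (AEStronglyMeasurable.mul ?_ hψm.comp_snd) hS
    exact (by fun_prop : Measurable fun p : ℝ × ℝ => p.1 ^ a).aestronglyMeasurable
  have hKv : ∀ v ∈ Set.Ioc (0 : ℝ) 1, ∀ g : ℝ → ℝ,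
      (∫ t, (Set.Iio v).indicator g t ∂μ) = ∫ t in Set.Ioo 0 v, g t := by
    intro v hv g
    rw [integral_indicator measurableSet_Iio, hμ, Measure.restrict_restrict measurableSet_Iio]
    congr 2
    ext t
    simp only [Set.mem_inter_iff, Set.mem_Iio, Set.mem_Ioc, Set.mem_Ioo]
    constructor
    · rintro ⟨h1, h2, h3⟩; exact ⟨h2, h1⟩
    · rintro ⟨h1, h2⟩; exact ⟨h2, h1, h2.le.trans hv.2⟩
  have hK1 : ∀ t v, K (t, v) = (Set.Iio v).indicator (fun t => t ^ a * ψ v) t := fun t v => rfl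
  have hK2 : ∀ t v, K (t, v) = (Set.Ioi t).indicator (fun v => t ^ a * ψ v) v := fun t v => rfl
  have hKi : Integrable K (μ.prod μ) := by
    rw [integrable_prod_iff' hKm]
    constructor
    · filter_upwards [ae_restrict_mem measurableSet_Ioc] with v hv
      simp only [hK1]
      rw [integrable_indicator_iff measurableSet_Iio]
      have h1 := (integral_rpow_Ioo ha hv.1).1.mul_const (ψ v)
      rw [IntegrableOn, hμ, Measure.restrict_restrict measurableSet_Iio]
      refine IntegrableOn.mono_set h1 ?_
      rintro t ⟨h2, h3, _⟩
      exact ⟨h3, h2⟩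
    · refine (hψ.norm.div_const (a + 1)).congr ?_
      filter_upwards [ae_restrict_mem measurableSet_Ioc] with v hv
      have h1 : ∀ t, ‖K (t, v)‖ = (Set.Iio v).indicator (fun t => ‖t ^ a * ψ v‖) t := by
        intro t; rw [hK1, norm_indicator_eq_indicator_norm]
      simp only [h1]
      rw [hKv v hv]
      have h2 : ∀ t ∈ Set.Ioo 0 v, ‖t ^ a * ψ v‖ = t ^ a * ‖ψ v‖ := by
        intro t ht
        rw [norm_mul, Real.norm_of_nonneg (Real.rpow_nonneg ht.1.le _)]
      rw [setIntegral_congr_fun measurableSet_Ioo h2, integral_mul_const,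
        (integral_rpow_Ioo ha hv.1).2, norm_mul, Real.norm_of_nonneg (Real.rpow_nonneg hv.1.le _)]
      ring
  have hinner : ∀ t ∈ Set.Ioc (0 : ℝ) 1, ∫ v, K (t, v) ∂μ = -(φ t * t ^ a) := by
    intro t ht
    simp only [hK2]
    rw [integral_indicator measurableSet_Ioi, hμ, Measure.restrict_restrict measurableSet_Ioi,
      hφ t ht, intervalIntegral.integral_of_le ht.2, integral_const_mul]
    have : Set.Ioi t ∩ Set.Ioc 0 1 = Set.Ioc t 1 := by
      ext v
      simp only [Set.mem_inter_iff, Set.mem_Ioi, Set.mem_Ioc]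
      constructor
      · rintro ⟨h1, h2, h3⟩; exact ⟨h1, h3⟩
      · rintro ⟨h1, h2⟩; exact ⟨h1, ht.1.trans h1, h2⟩
    rw [this]
    ring
  have hae : (fun t => ∫ v, K (t, v) ∂μ) =ᵐ[μ] fun t => -(φ t * t ^ a) := by
    filter_upwards [ae_restrict_mem measurableSet_Ioc] with t ht using hinner t ht
  constructor
  · have := (hKi.integral_prod_left.congr hae).neg
    refine this.congr (.of_forall fun t => ?_)
    simp
  · have h1 := integral_integral_swap (f := fun t v => K (t, v)) hKi
    rw [integral_congr_ae hae, integral_neg] at h1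
    have h2 : ∫ v, ∫ t, K (t, v) ∂μ ∂μ = ∫ v, (1 / (a + 1)) * (ψ v * v ^ (a + 1)) ∂μ := by
      refine integral_congr_ae ?_
      filter_upwards [ae_restrict_mem measurableSet_Ioc] with v hv
      simp only [hK1]
      rw [hKv v hv, integral_mul_const, (integral_rpow_Ioo ha hv.1).2]
      ring
    rw [h2, integral_const_mul] at h1
    linarith

/-- Here `c = (-1)^s / ((b+1)⋯(b+s))`. It is chosen before `φ`, so that the dual polynomial does not
depend on `f`. -/
theorem IsACChain.integral_mul_rpow (s : ℕ) : ∀ {b : ℝ}, -1 < b → ∃ c : ℝ, c ≠ 0 ∧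
    ∀ φ : ℕ → ℝ → ℝ, IsACChain s φ → (∀ k < s, φ k 1 = 0) →
      IntegrableOn (fun v => φ s v * v ^ (b + s)) (Set.Ioc 0 1) →
      IntegrableOn (fun t => φ 0 t * t ^ b) (Set.Ioc 0 1) ∧
      ∫ t in Set.Ioc 0 1, φ 0 t * t ^ b = c * ∫ v in Set.Ioc 0 1, φ s v * v ^ (b + s) := by
  induction s with
  | zero =>
    intro b _
    refine ⟨1, one_ne_zero, fun φ _ _ h => ?_⟩
    simpa using h
  | succ s ih =>
    intro b hb
    obtain ⟨c, hc, H⟩ := ih (b := b + 1) (by linarith)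
    refine ⟨-(1 / (b + 1)) * c,
      mul_ne_zero (neg_ne_zero.2 (one_div_ne_zero (by linarith))) hc, fun φ h h1 hi => ?_⟩
    have e : b + 1 + (s : ℝ) = b + ((s + 1 : ℕ) : ℝ) := by push_cast; ring
    obtain ⟨h2, h3⟩ := H (fun k => φ (k + 1)) h.tail (fun k hk => h1 (k + 1) (by omega))
      (by rw [e]; exact hi)
    obtain ⟨h4, h5⟩ := integral_primitive_mul_rpow hb (φ := φ 0) (ψ := φ 1) h2 (fun t ht => by
      have := (h 0 (by omega) t ht).2
      rw [h1 0 (by omega)] at this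
      rw [← this]; ring)
    refine ⟨h4, ?_⟩
    rw [h5, mul_assoc]
    congr 1
    simp only [zero_add, e] at h3
    exact h3

end AbsolutelyContinuousChains

/-! ### Polar form of the cone measure and its null sets -/

section ConeMeasure

variable {d : ℕ}

/-- The radial density `t^(d-1) t^β (1-t)^γ` of the weighted measure on the cone. -/
def radialWeight (d : ℕ) (β γ t : ℝ) : ℝ := t ^ (d - 1) * (t ^ β * (1 - t) ^ γ)

/-- The radial part of the weighted measure on the cone. -/
def radialMeasure (d : ℕ) (β γ : ℝ) : Measure ℝ :=
  ((volume : Measure ℝ).restrict (Set.Ioc 0 1)).withDensity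
    (fun t => ENNReal.ofReal (radialWeight d β γ t))

@[fun_prop]
theorem measurable_radialWeight (β γ : ℝ) : Measurable (radialWeight d β γ) := by
  unfold radialWeight
  fun_prop

theorem radialWeight_nonneg (β γ : ℝ) {t : ℝ} (ht : t ∈ Set.Ioc (0 : ℝ) 1) :
    0 ≤ radialWeight d β γ t :=
  mul_nonneg (pow_nonneg ht.1.le _)
    (mul_nonneg (Real.rpow_nonneg ht.1.le _) (Real.rpow_nonneg (by linarith [ht.2]) _))

theorem measurable_conePoint :
    Measurable (fun p : ℝ × UnitSphere d => conePoint p.1 p.2) :=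
  (continuous_conePoint d).measurable

instance (β γ : ℝ) : SigmaFinite (radialMeasure d β γ) := by
  unfold radialMeasure
  exact SigmaFinite.withDensity_ofReal _

/-- The weight depends on `t` alone, so it can be moved into the radial factor; the clamping in
`conePoint` is inactive on `(0, 1]`. -/
theorem weightedConeMeasure_eq (β γ : ℝ) :
    weightedConeMeasure d β γ = ((radialMeasure d β γ).prod (sphereMeasure d)).map
      (fun p : ℝ × UnitSphere d => conePoint p.1 p.2) := by
  have hw : Measurable fun p : ConeSurface d =>
      ENNReal.ofReal (p.1.2 ^ β * (1 - p.1.2) ^ γ) := by fun_prop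
  have h1 : radialMeasure d β γ =
      (((volume : Measure ℝ).restrict (Set.Ioc 0 1)).withDensity
        (fun t => ENNReal.ofReal (t ^ (d - 1)))).withDensity
        (fun t => ENNReal.ofReal (t ^ β * (1 - t) ^ γ)) := by
    rw [radialMeasure, ← withDensity_mul _ (by fun_prop) (by fun_prop)]
    refine withDensity_congr_ae ?_
    filter_upwards [ae_restrict_mem measurableSet_Ioc] with t ht
    simp only [radialWeight, Pi.mul_apply]
    rw [ENNReal.ofReal_mul (pow_nonneg ht.1.le _)]
  have hsf : SFinite (((volume : Measure ℝ).restrict (Set.Ioc 0 1)).withDensity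
        (fun t => ENNReal.ofReal (t ^ (d - 1)))) := inferInstance
  rw [h1, prod_withDensity_left (by fun_prop)]
  rw [weightedConeMeasure, coneMeasure]
  set ν := (((volume : Measure ℝ).restrict (Set.Ioc 0 1)).withDensity
        (fun t => ENNReal.ofReal (t ^ (d - 1)))).prod (sphereMeasure d) with hν
  have hae : ∀ᵐ z ∂ν, z.1 ∈ Set.Ioc (0 : ℝ) 1 := by
    have h2 : ∀ᵐ t ∂(((volume : Measure ℝ).restrict (Set.Ioc 0 1)).withDensity
        (fun t => ENNReal.ofReal (t ^ (d - 1)))), t ∈ Set.Ioc (0 : ℝ) 1 :=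
      (withDensity_absolutelyContinuous _ _).ae_le (ae_restrict_mem measurableSet_Ioc)
    exact Measure.quasiMeasurePreserving_fst.ae h2
  ext A hA
  rw [withDensity_apply _ hA, setLIntegral_map hA hw measurable_conePoint,
    Measure.map_apply measurable_conePoint hA, withDensity_apply _ (measurable_conePoint hA)]
  refine lintegral_congr_ae (ae_restrict_of_ae ?_)
  filter_upwards [hae] with z hz
  rw [conePoint_val hz.1.le hz.2]

theorem integrable_weightedCone_iff {β γ : ℝ} {F : ConeSurface d → ℝ}
    (hF : AEStronglyMeasurable F (weightedConeMeasure d β γ)) :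
    Integrable F (weightedConeMeasure d β γ) ↔
      Integrable (fun p : ℝ × UnitSphere d => F (conePoint p.1 p.2))
        ((radialMeasure d β γ).prod (sphereMeasure d)) := by
  rw [weightedConeMeasure_eq] at hF ⊢
  exact integrable_map_measure hF measurable_conePoint.aemeasurable

theorem integrable_radialMeasure_iff {β γ : ℝ} {φ : ℝ → ℝ} :
    Integrable φ (radialMeasure d β γ) ↔
      IntegrableOn (fun t => radialWeight d β γ t * φ t) (Set.Ioc 0 1) := by
  rw [radialMeasure, integrable_withDensity_iff_integrable_smul' (by fun_prop) (by simp)]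
  refine integrable_congr ?_
  filter_upwards [ae_restrict_mem measurableSet_Ioc] with t ht
  rw [ENNReal.toReal_ofReal (radialWeight_nonneg β γ ht), smul_eq_mul]

theorem integral_radialMeasure {β γ : ℝ} (φ : ℝ → ℝ) :
    ∫ t, φ t ∂(radialMeasure d β γ) = ∫ t in Set.Ioc 0 1, radialWeight d β γ t * φ t := by
  rw [radialMeasure, integral_withDensity_eq_integral_toReal_smul (by fun_prop) (by simp)]
  refine integral_congr_ae ?_
  filter_upwards [ae_restrict_mem measurableSet_Ioc] with t ht
  rw [ENNReal.toReal_ofReal (radialWeight_nonneg β γ ht), smul_eq_mul]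

theorem integral_weightedCone {β γ : ℝ} {F : ConeSurface d → ℝ}
    (hF : Integrable F (weightedConeMeasure d β γ)) :
    IntegrableOn (fun t => radialWeight d β γ t * ∫ ξ, F (conePoint t ξ) ∂(sphereMeasure d))
      (Set.Ioc 0 1) ∧
    ∫ p, F p ∂(weightedConeMeasure d β γ) = ∫ t in Set.Ioc 0 1,
      radialWeight d β γ t * ∫ ξ, F (conePoint t ξ) ∂(sphereMeasure d) := by
  have h1 := (integrable_weightedCone_iff hF.aestronglyMeasurable).1 hF
  refine ⟨integrable_radialMeasure_iff.1 h1.integral_prod_left, ?_⟩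
  rw [← integral_radialMeasure, ← integral_prod _ h1]
  have h2 := hF.aestronglyMeasurable
  rw [weightedConeMeasure_eq] at h2 ⊢
  exact integral_map measurable_conePoint.aemeasurable h2

/-- The radial density is at most `t^(β+d-1)`, integrable exactly because `β > -d`. -/
theorem isFiniteMeasure_weightedCone (hd : 1 ≤ d) {β γ : ℝ} (hβ : -(d : ℝ) < β) (hγ : 0 ≤ γ) :
    IsFiniteMeasure (weightedConeMeasure d β γ) := by
  have h1 : IntegrableOn (fun t => radialWeight d β γ t * 1) (Set.Ioc 0 1) := by
    have h2 : IntegrableOn (fun t : ℝ => t ^ (β + (d - 1 : ℝ))) (Set.Ioc 0 1) := by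
      rw [integrableOn_Ioc_iff_integrableOn_Ioo]
      exact (integral_rpow_Ioo (by linarith) one_pos).1
    refine Integrable.mono h2 (by fun_prop) ?_
    filter_upwards [ae_restrict_mem measurableSet_Ioc] with t ht
    rw [mul_one, Real.norm_of_nonneg (radialWeight_nonneg β γ ht),
      Real.norm_of_nonneg (Real.rpow_nonneg ht.1.le _), Real.rpow_add ht.1, radialWeight]
    have h3 : t ^ (d - 1) = t ^ (d - 1 : ℝ) := by
      rw [← Real.rpow_natCast, Nat.cast_sub hd, Nat.cast_one]
    have h4 : (1 - t) ^ γ ≤ 1 := Real.rpow_le_one (by linarith [ht.2]) (by linarith [ht.1]) hγ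
    rw [h3, mul_comm, mul_assoc, mul_comm _ (t ^ (d - 1 : ℝ))]
    refine mul_le_mul_of_nonneg_left ?_ (Real.rpow_nonneg ht.1.le _)
    exact mul_le_of_le_one_right (Real.rpow_nonneg ht.1.le _) h4
  have h5 := integrable_radialMeasure_iff.2 h1
  have h6 : IsFiniteMeasure (radialMeasure d β γ) := by
    rwa [integrable_const_iff_isFiniteMeasure one_ne_zero] at h5
  rw [weightedConeMeasure_eq]
  infer_instance

instance : CompactSpace (ConeSurface d) := by
  refine isCompact_iff_compactSpace.1 (Metric.isCompact_of_isClosed_isBounded ?_ ?_)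
  · refine IsClosed.inter (isClosed_eq (by fun_prop) (by fun_prop)) (IsClosed.inter ?_ ?_)
    · exact isClosed_le continuous_const continuous_snd
    · exact isClosed_le continuous_snd continuous_const
  · refine (Metric.isBounded_closedBall (x := (0 : EuclideanSpace ℝ (Fin d) × ℝ))
      (r := 1)).subset ?_
    rintro ⟨x, t⟩ ⟨h1, h2, h3⟩
    rw [mem_closedBall_zero_iff, Prod.norm_def]
    simp only at h1 h2 h3 ⊢
    rw [h1, Real.norm_of_nonneg h2, max_self]
    exact h3

theorem memLp_of_continuous_cone {μ : Measure (ConeSurface d)} [IsFiniteMeasure μ]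
    {F : ConeSurface d → ℝ} (hF : Continuous F) : MemLp F 2 μ := by
  obtain ⟨C, hC⟩ := isCompact_univ.exists_bound_of_continuousOn hF.continuousOn
  exact MemLp.of_bound hF.aestronglyMeasurable C (.of_forall fun p => hC p trivial)

theorem memLp_of_continuous_sphere {F : UnitSphere d → ℝ} (hF : Continuous F) :
    MemLp F 2 (sphereMeasure d) := by
  obtain ⟨C, hC⟩ := isCompact_univ.exists_bound_of_continuousOn hF.continuousOn
  exact MemLp.of_bound hF.aestronglyMeasurable C (.of_forall fun p => hC p trivial)

theorem continuous_slice {F : ConeSurface d → ℝ} (hF : Continuous F) (t : ℝ) :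
    Continuous fun ξ : UnitSphere d => F (conePoint t ξ) :=
  hF.comp ((continuous_conePoint d).comp (Continuous.prodMk_right t))

theorem exists_conePoint_eq (hd : 1 ≤ d) (p : ConeSurface d) :
    ∃ ξ : UnitSphere d, conePoint p.1.2 ξ = p := by
  have := nontrivial_euclideanSpace hd
  rcases eq_or_lt_of_le p.2.2.1 with h | h
  · obtain ⟨ξ⟩ : Nonempty (UnitSphere d) := (NormedSpace.sphere_nonempty.2 zero_le_one).to_subtype
    refine ⟨ξ, Subtype.ext ?_⟩
    rw [conePoint_val p.2.2.1 p.2.2.2]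
    refine Prod.ext ?_ rfl
    have h1 : p.1.1 = 0 := by rw [← norm_eq_zero, p.2.1, ← h]
    simp [← h, h1]
  · refine ⟨⟨(p.1.2)⁻¹ • p.1.1, ?_⟩, Subtype.ext ?_⟩
    · rw [mem_sphere_zero_iff_norm, norm_smul, p.2.1, Real.norm_of_nonneg (inv_nonneg.2 h.le),
        inv_mul_cancel₀ h.ne']
    · rw [conePoint_val p.2.2.1 p.2.2.2]
      refine Prod.ext ?_ rfl
      simp [smul_smul, mul_inv_cancel₀ h.ne']

/-- A continuous function on the cone that vanishes away from the apex and the rim vanishes. -/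
theorem eq_zero_of_conePoint_eq_zero (hd : 1 ≤ d) {F : ConeSurface d → ℝ} (hF : Continuous F)
    (h : ∀ t ∈ Set.Ioo (0 : ℝ) 1, ∀ ξ, F (conePoint t ξ) = 0) (p : ConeSurface d) : F p = 0 := by
  obtain ⟨ξ, hξ⟩ := exists_conePoint_eq hd p
  have hc : Continuous fun t : ℝ => F (conePoint t ξ) :=
    hF.comp ((continuous_conePoint d).comp (Continuous.prodMk_left ξ))
  have h1 : Set.Icc (0 : ℝ) 1 ⊆ {t | F (conePoint t ξ) = 0} := by
    rw [← closure_Ioo zero_ne_one]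
    exact closure_minimal (fun t ht => h t ht ξ) (isClosed_eq hc continuous_const)
  rw [← hξ]
  exact h1 p.2.2

theorem slice_eq_zero_of_ae {F : ConeSurface d → ℝ} (hF : Continuous F) {t : ℝ}
    (h : (fun ξ : UnitSphere d => F (conePoint t ξ)) =ᵐ[sphereMeasure d] 0) (ξ : UnitSphere d) :
    F (conePoint t ξ) = 0 :=
  congr_fun (Continuous.ae_eq_iff_eq (sphereMeasure d) (continuous_slice hF t)
    continuous_const |>.1 h) ξ

theorem ae_ae_of_ae_coneMeasure {P : ConeSurface d → Prop} (h : ∀ᵐ p ∂(coneMeasure d), P p) :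
    ∀ᵐ t ∂((volume : Measure ℝ).restrict (Set.Ioc 0 1)), ∀ᵐ ξ ∂(sphereMeasure d),
      P (conePoint t ξ) := by
  have h1 := Measure.ae_ae_of_ae_prod
    (Measure.QuasiMeasurePreserving.ae
      ⟨measurable_conePoint, Measure.AbsolutelyContinuous.rfl⟩ h)
  rw [ae_withDensity_iff (by fun_prop)] at h1
  filter_upwards [h1, ae_restrict_mem measurableSet_Ioc] with t ht htI
  exact ht (by simpa using pow_pos htI.1 _)

theorem ae_coneMeasure_eq_zero {F : ConeSurface d → ℝ}
    (hF : AEStronglyMeasurable F (coneMeasure d))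
    (h : ∀ᵐ t ∂((volume : Measure ℝ).restrict (Set.Ioc 0 1)),
      (fun ξ : UnitSphere d => F (conePoint t ξ)) =ᵐ[sphereMeasure d] 0) :
    F =ᵐ[coneMeasure d] 0 := by
  -- Testing a null set slice by slice needs a measurable set, hence the measurable representative.
  set G := hF.mk F with hG
  have hGm : Measurable G := hF.stronglyMeasurable_mk.measurable
  refine hF.ae_eq_mk.trans ?_
  have hS : MeasurableSet {p : ConeSurface d | G p = 0} := hGm (measurableSet_singleton 0)
  change ∀ᵐ p ∂(coneMeasure d), G p = 0
  rw [coneMeasure, ae_map_iff measurable_conePoint.aemeasurable hS]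
  refine (Measure.ae_prod_iff_ae_ae (measurable_conePoint hS)).2 ?_
  refine (withDensity_absolutelyContinuous _ _).ae_le ?_
  filter_upwards [h, ae_ae_of_ae_coneMeasure hF.ae_eq_mk] with t h1 h2
  filter_upwards [h1, h2] with ξ h3 h4
  rw [hG, ← h4]
  exact h3

theorem ae_weightedCone_of_ae {P : ConeSurface d → Prop} (h : ∀ᵐ p ∂(coneMeasure d), P p)
    (β γ : ℝ) : ∀ᵐ p ∂(weightedConeMeasure d β γ), P p :=
  (withDensity_absolutelyContinuous _ _).ae_le h

/-- The radial density is positive on `(0, 1)`, and the rim `t = 1` is a single value. -/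
theorem ae_of_ae_weightedCone {P : ConeSurface d → Prop} {β γ : ℝ}
    (h : ∀ᵐ p ∂(weightedConeMeasure d β γ), P p) :
    ∀ᵐ t ∂((volume : Measure ℝ).restrict (Set.Ioc 0 1)), ∀ᵐ ξ ∂(sphereMeasure d),
      P (conePoint t ξ) := by
  rw [weightedConeMeasure_eq] at h
  have h1 := Measure.ae_ae_of_ae_prod
    (Measure.QuasiMeasurePreserving.ae
      ⟨measurable_conePoint, Measure.AbsolutelyContinuous.rfl⟩ h)
  rw [radialMeasure, ae_withDensity_iff (by fun_prop)] at h1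
  have h2 : ∀ᵐ t ∂((volume : Measure ℝ).restrict (Set.Ioc 0 1)), t ≠ 1 :=
    ae_restrict_of_ae (by simp [ae_iff])
  filter_upwards [h1, ae_restrict_mem measurableSet_Ioc, h2] with t ht htI ht1
  refine ht ?_
  have h3 : t < 1 := lt_of_le_of_ne htI.2 ht1
  have : 0 < radialWeight d β γ t := mul_pos (pow_pos htI.1 _)
    (mul_pos (Real.rpow_pos_of_pos htI.1 _) (Real.rpow_pos_of_pos (by linarith) _))
  simpa using this

end ConeMeasure

/-! ### The derivative `∂_t`, its uniqueness, and the Sobolev inner product -/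

section TDerivatives

open MvPolynomial

variable {d : ℕ}

theorem MeasureTheory.MemLp.integrable_fun_mul {α : Type*} [MeasurableSpace α] {μ : Measure α}
    {f g : α → ℝ} (hf : MemLp f 2 μ) (hg : MemLp g 2 μ) : Integrable (fun x => f x * g x) μ :=
  hf.integrable_mul hg

theorem harmonicCoeff_eq (F : ConeSurface d → ℝ) (m : ℕ) (Y : MvPolynomial (Fin d) ℝ) (t : ℝ) :
    harmonicCoeff F m Y t = (t ^ m)⁻¹ * ((1 / sphereArea d) *
      ∫ ξ, F (conePoint t ξ) * sphereEval Y ξ ∂(sphereMeasure d)) := rfl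

theorem integral_slice_eq (hd : 1 ≤ d) (F : ConeSurface d → ℝ) (m : ℕ)
    (Y : MvPolynomial (Fin d) ℝ) {t : ℝ} (ht : 0 < t) :
    ∫ ξ, F (conePoint t ξ) * sphereEval Y ξ ∂(sphereMeasure d) =
      sphereArea d * (t ^ m * harmonicCoeff F m Y t) := by
  have h1 := (sphereArea_pos hd).ne'
  have h2 := (pow_pos ht m).ne'
  rw [harmonicCoeff_eq]
  field_simp

theorem memLp_sphereEval (Y : MvPolynomial (Fin d) ℝ) :
    MemLp (sphereEval Y) 2 (sphereMeasure d) :=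
  memLp_of_continuous_sphere (continuous_sphereEval Y)

/-- Stated along a filter to serve both a single slice (`pure ()`) and almost every slice. -/
theorem integral_monomial_eq_zero (hd : 1 ≤ d) {ι : Type*} {l : Filter ι}
    {g : ι → UnitSphere d → ℝ} (hg : ∀ᶠ i in l, MemLp (g i) 2 (sphereMeasure d))
    (h : ∀ m Y, IsSolidHarmonic m Y →
      ∀ᶠ i in l, ∫ ξ, g i ξ * sphereEval Y ξ ∂(sphereMeasure d) = 0) (a : Fin d →₀ ℕ) :
    ∀ᶠ i in l, ∫ ξ, g i ξ * sphereEval (monomial a 1) ξ ∂(sphereMeasure d) = 0 := by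
  suffices H : ∀ φ ∈ Submodule.span ℝ
      {φ : UnitSphere d → ℝ | ∃ m Y, IsSolidHarmonic m Y ∧ φ = sphereEval Y},
      MemLp φ 2 (sphereMeasure d) ∧
        ∀ᶠ i in l, ∫ ξ, g i ξ * φ ξ ∂(sphereMeasure d) = 0 from
    (H _ (exists_sum_solidHarmonic hd a)).2
  intro φ hφ
  induction hφ using Submodule.span_induction with
  | mem φ hφ =>
    obtain ⟨m, Y, hY, rfl⟩ := hφ
    exact ⟨memLp_sphereEval Y, h m Y hY⟩
  | zero => exact ⟨MemLp.zero, by simp⟩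
  | add φ ψ _ _ h1 h2 =>
    refine ⟨h1.1.add h2.1, ?_⟩
    filter_upwards [hg, h1.2, h2.2] with i hi h3 h4
    simp only [Pi.add_apply, mul_add]
    rw [integral_add (hi.integrable_fun_mul h1.1) (hi.integrable_fun_mul h2.1), h3, h4, add_zero]
  | smul c φ _ h1 =>
    refine ⟨h1.1.const_smul c, ?_⟩
    filter_upwards [h1.2] with i h3
    simp only [Pi.smul_apply, smul_eq_mul, mul_left_comm _ c]
    rw [integral_const_mul, h3, mul_zero]

theorem slice_ae_eq_zero (hd : 1 ≤ d) {G : ConeSurface d → ℝ} {t : ℝ} (ht : 0 < t)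
    (hG : MemLp (fun ξ : UnitSphere d => G (conePoint t ξ)) 2 (sphereMeasure d))
    (h : ∀ m Y, IsSolidHarmonic m Y → harmonicCoeff G m Y t = 0) :
    (fun ξ : UnitSphere d => G (conePoint t ξ)) =ᵐ[sphereMeasure d] 0 := by
  refine ae_eq_zero_of_integral_monomial hG fun a => ?_
  refine integral_monomial_eq_zero (l := pure ()) (g := fun _ ξ => G (conePoint t ξ)) hd
    (by simpa using hG) (fun m Y hY => ?_) a
  simpa [h m Y hY] using integral_slice_eq hd G m Y ht

/-- The exceptional null set depends on `Y`. Passing to monomials leaves only countably many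
conditions, so the null sets can be united. -/
theorem top_ae_eq_zero (hd : 1 ≤ d) {G : ConeSurface d → ℝ}
    (hGm : AEStronglyMeasurable G (coneMeasure d))
    (hG : ∀ᵐ t ∂((volume : Measure ℝ).restrict (Set.Ioc 0 1)),
      MemLp (fun ξ : UnitSphere d => G (conePoint t ξ)) 2 (sphereMeasure d))
    (h : ∀ m Y, IsSolidHarmonic m Y →
      ∀ᵐ t ∂((volume : Measure ℝ).restrict (Set.Ioc 0 1)), harmonicCoeff G m Y t = 0) :
    G =ᵐ[coneMeasure d] 0 := by
  refine ae_coneMeasure_eq_zero hGm ?_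
  have h1 := ae_all_iff.2 (integral_monomial_eq_zero hd hG fun m Y hY => by
    filter_upwards [h m Y hY, ae_restrict_mem measurableSet_Ioc] with t ht htI
    rw [integral_slice_eq hd G m Y htI.1, ht, mul_zero, mul_zero])
  filter_upwards [h1, hG] with t h2 h3
  exact ae_eq_zero_of_integral_monomial h3 h2

theorem harmonicCoeff_add_smul {F G : ConeSurface d → ℝ} {t : ℝ}
    (hF : MemLp (fun ξ : UnitSphere d => F (conePoint t ξ)) 2 (sphereMeasure d))
    (hG : MemLp (fun ξ : UnitSphere d => G (conePoint t ξ)) 2 (sphereMeasure d))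
    (a b : ℝ) (m : ℕ) (Y : MvPolynomial (Fin d) ℝ) :
    harmonicCoeff (a • F + b • G) m Y t =
      a * harmonicCoeff F m Y t + b * harmonicCoeff G m Y t := by
  have h1 : ∀ ξ : UnitSphere d, (a • F + b • G) (conePoint t ξ) * sphereEval Y ξ =
      a * (F (conePoint t ξ) * sphereEval Y ξ) + b * (G (conePoint t ξ) * sphereEval Y ξ) := by
    intro ξ; simp; ring
  simp only [harmonicCoeff_eq, h1]
  rw [integral_add ((hF.integrable_fun_mul (memLp_sphereEval Y)).const_mul a)
    ((hG.integrable_fun_mul (memLp_sphereEval Y)).const_mul b), integral_const_mul, integral_const_mul]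
  ring

theorem IsTDerivChain.isACChain {s : ℕ} {F : ℕ → ConeSurface d → ℝ} (hF : IsTDerivChain s F)
    {m : ℕ} {Y : MvPolynomial (Fin d) ℝ} (hY : IsSolidHarmonic m Y) :
    IsACChain s (fun k => harmonicCoeff (F k) m Y) :=
  fun k hk t ht => hF.deriv k hk m Y hY t ht

theorem IsTDerivChain.ae_slice {s : ℕ} {F : ℕ → ConeSurface d → ℝ} (hF : IsTDerivChain s F)
    {k : ℕ} (hk : k ≤ s) : ∀ᵐ t ∂((volume : Measure ℝ).restrict (Set.Ioc 0 1)),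
      MemLp (fun ξ : UnitSphere d => F k (conePoint t ξ)) 2 (sphereMeasure d) := by
  rcases hk.lt_or_eq with h | rfl
  · filter_upwards [ae_restrict_mem measurableSet_Ioc] with t ht using hF.slice k h t ht
  · exact hF.slice_top

theorem IsTDerivChain.add_smul {s : ℕ} {F G : ℕ → ConeSurface d → ℝ} (hF : IsTDerivChain s F)
    (hG : IsTDerivChain s G) (a b : ℝ) : IsTDerivChain s (fun k => a • F k + b • G k) where
  slice k hk t ht := ((hF.slice k hk t ht).const_smul a).add ((hG.slice k hk t ht).const_smul b)
  meas_top := (hF.meas_top.const_smul a).add (hG.meas_top.const_smul b)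
  slice_top := by
    filter_upwards [hF.slice_top, hG.slice_top] with t h1 h2
    exact (h1.const_smul a).add (h2.const_smul b)
  deriv k hk m Y hY t ht := by
    obtain ⟨h1, h2⟩ := hF.deriv k hk m Y hY t ht
    obtain ⟨h3, h4⟩ := hG.deriv k hk m Y hY t ht
    have h1' : (1 : ℝ) ∈ Set.Ioc (0 : ℝ) 1 := ⟨one_pos, le_rfl⟩
    -- For `k + 1 = s` only almost every slice is in `L²`, so linearity of the coefficient holds
    -- only almost everywhere.
    have hae : ∀ᵐ v ∂(volume : Measure ℝ), v ∈ Set.uIoc t 1 →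
        a * harmonicCoeff (F (k + 1)) m Y v + b * harmonicCoeff (G (k + 1)) m Y v =
        harmonicCoeff (a • F (k + 1) + b • G (k + 1)) m Y v := by
      have h5 := hF.ae_slice (Nat.succ_le_of_lt hk)
      have h6 := hG.ae_slice (Nat.succ_le_of_lt hk)
      rw [ae_restrict_iff' measurableSet_Ioc] at h5 h6
      filter_upwards [h5, h6] with v h7 h8 hv
      rw [Set.uIoc_of_le ht.2] at hv
      have hv' : v ∈ Set.Ioc (0 : ℝ) 1 := ⟨ht.1.trans hv.1, hv.2⟩
      exact (harmonicCoeff_add_smul (h7 hv') (h8 hv') a b m Y).symm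
    have hint := (h1.const_mul a).add (h3.const_mul b)
    refine ⟨hint.congr_ae ?_, ?_⟩
    · rw [EventuallyEq, ae_restrict_iff' measurableSet_uIoc]
      exact hae
    · rw [harmonicCoeff_add_smul (hF.slice k hk t ht) (hG.slice k hk t ht),
        harmonicCoeff_add_smul (hF.slice k hk 1 h1') (hG.slice k hk 1 h1'),
        ← intervalIntegral.integral_congr_ae hae,
        intervalIntegral.integral_add (h1.const_mul a) (h3.const_mul b),
        intervalIntegral.integral_const_mul, intervalIntegral.integral_const_mul, ← h2, ← h4]
      ring

/-- The derivatives of a function are determined almost everywhere. -/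
theorem IsTDerivChain.unique (hd : 1 ≤ d) {s : ℕ} (hs : 1 ≤ s) {F G : ℕ → ConeSurface d → ℝ}
    (hF : IsTDerivChain s F) (hG : IsTDerivChain s G) (h0 : F 0 = G 0) :
    (∀ k < s, ∀ t ∈ Set.Ioc (0 : ℝ) 1, (fun ξ : UnitSphere d => F k (conePoint t ξ))
      =ᵐ[sphereMeasure d] fun ξ => G k (conePoint t ξ)) ∧ F s =ᵐ[coneMeasure d] G s := by
  have hD := hF.add_smul hG 1 (-1)
  have hz := fun m Y (hY : IsSolidHarmonic m Y) =>
    (hD.isACChain hY).eq_zero_of_zero hs fun t ht => by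
      simp [h0, harmonicCoeff_eq]
  refine ⟨fun k hk t ht => ?_, ?_⟩
  · have := slice_ae_eq_zero hd ht.1 (hD.slice k hk t ht) fun m Y hY => (hz m Y hY).1 k hk t ht
    filter_upwards [this] with ξ hξ
    simp only [Pi.add_apply, Pi.smul_apply, smul_eq_mul, Pi.zero_apply] at hξ
    linarith
  · have := top_ae_eq_zero hd hD.meas_top hD.slice_top fun m Y hY => (hz m Y hY).2
    filter_upwards [this] with p hp
    simp only [Pi.add_apply, Pi.smul_apply, smul_eq_mul, Pi.zero_apply] at hp
    linarith

theorem HasTDerivs.tDeriv_spec {s : ℕ} {f : ConeSurface d → ℝ} (h : HasTDerivs s f) :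
    tDeriv s f 0 = f ∧ IsTDerivChain s (tDeriv s f) := by
  have : tDeriv s f = h.choose := by
    funext k
    simp only [tDeriv, dif_pos h]
  rw [this]
  exact h.choose_spec

/-- `tDeriv` is a chosen chain; by uniqueness any explicit chain computes it almost everywhere. -/
theorem IsTDerivChain.tDeriv_ae (hd : 1 ≤ d) {s : ℕ} (hs : 1 ≤ s) {F : ℕ → ConeSurface d → ℝ}
    (hF : IsTDerivChain s F) :
    (∀ k < s, ∀ t ∈ Set.Ioc (0 : ℝ) 1, (fun ξ : UnitSphere d => tDeriv s (F 0) k (conePoint t ξ))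
      =ᵐ[sphereMeasure d] fun ξ => F k (conePoint t ξ)) ∧
      tDeriv s (F 0) s =ᵐ[coneMeasure d] F s := by
  have h : HasTDerivs s (F 0) := ⟨F, rfl, hF⟩
  exact h.tDeriv_spec.2.unique hd hs hF h.tDeriv_spec.1

theorem MemConeSobolev.add_smul (hd : 1 ≤ d) {β : ℝ} {s : ℕ} (hs : 1 ≤ s)
    {f g : ConeSurface d → ℝ} (hf : MemConeSobolev β s f) (hg : MemConeSobolev β s g) (a b : ℝ) :
    MemConeSobolev β s (a • f + b • g) := by
  have h1 := hf.2.1.tDeriv_spec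
  have h2 := hg.2.1.tDeriv_spec
  have h3 := h1.2.add_smul h2.2 a b
  have h4 := (h3.tDeriv_ae hd hs).2
  simp only [h1.1, h2.1] at h4
  refine ⟨(hf.1.const_smul a).add (hg.1.const_smul b), ⟨_, by simp only [h1.1, h2.1], h3⟩, ?_⟩
  exact ((hf.2.2.const_smul a).add (hg.2.2.const_smul b)).ae_eq
    (ae_weightedCone_of_ae (EventuallyEq.symm h4) _ _)

theorem tDeriv_add_smul (hd : 1 ≤ d) {s : ℕ} (hs : 1 ≤ s)
    {f g : ConeSurface d → ℝ} (hf : HasTDerivs s f) (hg : HasTDerivs s g) (a b : ℝ) :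
    (∀ k < s, (fun ξ : UnitSphere d => tDeriv s (a • f + b • g) k (conePoint 1 ξ))
      =ᵐ[sphereMeasure d]
        fun ξ => a * tDeriv s f k (conePoint 1 ξ) + b * tDeriv s g k (conePoint 1 ξ)) ∧
      tDeriv s (a • f + b • g) s =ᵐ[coneMeasure d]
        fun p => a * tDeriv s f s p + b * tDeriv s g s p := by
  have h1 := hf.tDeriv_spec
  have h2 := hg.tDeriv_spec
  have h4 := (h1.2.add_smul h2.2 a b).tDeriv_ae hd hs
  simp only [h1.1, h2.1] at h4
  exact ⟨fun k hk => h4.1 k hk 1 ⟨one_pos, le_rfl⟩, h4.2⟩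

theorem coneSobolevInner_comm (β : ℝ) (s : ℕ) (lam : ℕ → ℝ) (f g : ConeSurface d → ℝ) :
    coneSobolevInner β s lam f g = coneSobolevInner β s lam g f := by
  simp only [coneSobolevInner, mul_comm]

theorem coneSobolevInner_add_smul (hd : 1 ≤ d) {β : ℝ} {s : ℕ} (hs : 1 ≤ s) (lam : ℕ → ℝ)
    {f g h : ConeSurface d → ℝ} (hf : MemConeSobolev β s f) (hg : MemConeSobolev β s g)
    (hh : MemConeSobolev β s h) (a b : ℝ) :
    coneSobolevInner β s lam (a • f + b • g) h =
      a * coneSobolevInner β s lam f h + b * coneSobolevInner β s lam g h := by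
  obtain ⟨h1, h2⟩ := tDeriv_add_smul hd hs hf.2.1 hg.2.1 a b
  have e1 : ∫ p, tDeriv s (a • f + b • g) s p * tDeriv s h s p
        ∂(weightedConeMeasure d (β + s) 0) =
      a * ∫ p, tDeriv s f s p * tDeriv s h s p ∂(weightedConeMeasure d (β + s) 0) +
      b * ∫ p, tDeriv s g s p * tDeriv s h s p ∂(weightedConeMeasure d (β + s) 0) := by
    rw [← integral_const_mul, ← integral_const_mul, ← integral_add
      ((hf.2.2.integrable_fun_mul hh.2.2).const_mul a) ((hg.2.2.integrable_fun_mul hh.2.2).const_mul b)]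
    refine integral_congr_ae ?_
    filter_upwards [ae_weightedCone_of_ae h2 _ _] with p hp
    rw [hp]; ring
  have e2 : ∀ k < s, ∫ ξ : UnitSphere d, tDeriv s (a • f + b • g) k (conePoint 1 ξ) *
        tDeriv s h k (conePoint 1 ξ) ∂(sphereMeasure d) =
      a * ∫ ξ : UnitSphere d, tDeriv s f k (conePoint 1 ξ) *
        tDeriv s h k (conePoint 1 ξ) ∂(sphereMeasure d) +
      b * ∫ ξ : UnitSphere d, tDeriv s g k (conePoint 1 ξ) *
        tDeriv s h k (conePoint 1 ξ) ∂(sphereMeasure d) := by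
    intro k hk
    have hsl := fun {φ : ConeSurface d → ℝ} (hφ : MemConeSobolev β s φ) =>
      hφ.2.1.tDeriv_spec.2.slice k hk 1 ⟨one_pos, le_rfl⟩
    rw [← integral_const_mul, ← integral_const_mul, ← integral_add
      (((hsl hf).integrable_fun_mul (hsl hh)).const_mul a)
      (((hsl hg).integrable_fun_mul (hsl hh)).const_mul b)]
    refine integral_congr_ae ?_
    filter_upwards [h1 k hk] with ξ hξ
    rw [hξ]; ring
  simp only [coneSobolevInner]
  rw [e1, Finset.sum_congr rfl fun k hk => by rw [e2 k (Finset.mem_range.1 hk)]]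
  simp only [mul_add, Finset.sum_add_distrib, Finset.mul_sum]
  have e3 : ∀ c x y : ℝ, x * (c * y) = c * (x * y) := fun c x y => by ring
  simp only [e3 a, e3 b]
  ring

/-- All terms are nonnegative, so the top derivative and the rim traces vanish. Every coefficient of
`f` is then zero, and completeness and continuity give `f = 0`. -/
theorem coneSobolevInner_self_eq_zero (hd : 1 ≤ d) {β : ℝ} {s : ℕ} (hs : 1 ≤ s) {lam : ℕ → ℝ}
    (hlam : ∀ k < s, 0 < lam k) {f : ConeSurface d → ℝ} (hf : MemConeSobolev β s f)
    (h : coneSobolevInner β s lam f f = 0) : f = 0 := by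
  have hω := sphereArea_pos hd
  obtain ⟨h0, hc⟩ := hf.2.1.tDeriv_spec
  have hsq : ∀ x : ℝ, 0 ≤ x * x := fun x => mul_self_nonneg x
  have hsum : ∀ k ∈ Finset.range s, 0 ≤ (lam k / sphereArea d) *
      ∫ ξ : UnitSphere d, tDeriv s f k (conePoint 1 ξ) * tDeriv s f k (conePoint 1 ξ)
        ∂(sphereMeasure d) := fun k hk =>
    mul_nonneg (div_pos (hlam k (Finset.mem_range.1 hk)) hω).le (integral_nonneg fun ξ => hsq _)
  have htop : 0 ≤ (1 / sphereArea d) *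
      ∫ p, tDeriv s f s p * tDeriv s f s p ∂(weightedConeMeasure d (β + s) 0) :=
    mul_nonneg (one_div_pos.2 hω).le (integral_nonneg fun p => hsq _)
  have hz := (add_eq_zero_iff_of_nonneg htop (Finset.sum_nonneg hsum)).1 h
  have h1 : ∀ᵐ p ∂(weightedConeMeasure d (β + s) 0), tDeriv s f s p = 0 := by
    have h2 := (mul_eq_zero.1 hz.1).resolve_left (one_div_pos.2 hω).ne'
    rw [integral_eq_zero_iff_of_nonneg (fun p => hsq _) (hf.2.2.integrable_fun_mul hf.2.2)] at h2
    filter_upwards [h2] with p hp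
    simpa using hp
  have h2 : ∀ k < s, ∀ᵐ ξ ∂(sphereMeasure d), tDeriv s f k (conePoint 1 ξ) = 0 := by
    intro k hk
    have h3 := (Finset.sum_eq_zero_iff_of_nonneg hsum).1 hz.2 k (Finset.mem_range.2 hk)
    have h4 := (mul_eq_zero.1 h3).resolve_left (div_pos (hlam k hk) hω).ne'
    have hm := hc.slice k hk 1 ⟨one_pos, le_rfl⟩
    rw [integral_eq_zero_iff_of_nonneg (fun p => hsq _) (hm.integrable_fun_mul hm)] at h4
    filter_upwards [h4] with p hp
    simpa using hp
  have h3 := ae_of_ae_weightedCone h1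
  have hcoef : ∀ (F : ConeSurface d → ℝ) (m : ℕ) (Y : MvPolynomial (Fin d) ℝ) (t : ℝ),
      (∀ᵐ ξ ∂(sphereMeasure d), F (conePoint t ξ) = 0) → harmonicCoeff F m Y t = 0 := by
    intro F m Y t hF
    rw [harmonicCoeff_eq, integral_eq_zero_of_ae, mul_zero, mul_zero]
    filter_upwards [hF] with ξ hξ
    simp [hξ]
  have h4 : ∀ m Y, IsSolidHarmonic m Y → ∀ t ∈ Set.Ioc (0 : ℝ) 1, harmonicCoeff f m Y t = 0 := by
    intro m Y hY
    have := (hc.isACChain hY).eq_zero_of_top hs (fun k hk => hcoef _ m Y 1 (h2 k hk)) (by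
      filter_upwards [h3] with t ht using hcoef _ m Y t ht)
    rwa [h0] at this
  funext p
  refine eq_zero_of_conePoint_eq_zero hd hf.1 (fun t ht ξ => ?_) p
  refine slice_eq_zero_of_ae hf.1 (slice_ae_eq_zero hd ht.1
    (memLp_of_continuous_sphere (continuous_slice hf.1 t)) fun m Y hY => ?_) ξ
  exact h4 m Y hY t ⟨ht.1, ht.2.le⟩

theorem coneHarmonic_conePoint {k m : ℕ} {Y : MvPolynomial (Fin d) ℝ} (hY : IsSolidHarmonic m Y)
    {t : ℝ} (ht : t ∈ Set.Ioc (0 : ℝ) 1) (ξ : UnitSphere d) :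
    coneHarmonic k Y (conePoint t ξ) = t ^ (k + m) * sphereEval Y ξ := by
  rw [coneHarmonic, conePoint_val ht.1.le ht.2, pow_add, mul_assoc, sphereEval,
    ← hY.1.eval_smul' t]
  simp

theorem continuous_coneHarmonic (k : ℕ) (Y : MvPolynomial (Fin d) ℝ) :
    Continuous (coneHarmonic (d := d) k Y) := by
  unfold coneHarmonic
  refine Continuous.mul (by fun_prop) ((continuous_eval_euclidean Y).comp (by fun_prop))

/-- For equal degrees the factor `t^(-m)` cancels the homogeneity of `Y`; for different degrees both
sides vanish by orthogonality. -/
theorem harmonicCoeff_coneHarmonic (hd : 1 ≤ d) {m n : ℕ} {Y Z : MvPolynomial (Fin d) ℝ}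
    (hY : IsSolidHarmonic m Y) (hZ : IsSolidHarmonic n Z) (a : ℝ) (k : ℕ) {t : ℝ}
    (ht : t ∈ Set.Ioc (0 : ℝ) 1) :
    harmonicCoeff (a • coneHarmonic k Y) n Z t = ((1 / sphereArea d) *
      ∫ ξ, sphereEval Y ξ * sphereEval Z ξ ∂(sphereMeasure d)) * (a * t ^ k) := by
  rw [harmonicCoeff_eq]
  simp only [Pi.smul_apply, coneHarmonic_conePoint hY ht, smul_eq_mul, mul_assoc]
  rw [integral_const_mul, integral_const_mul]
  by_cases h : m = n
  · subst h
    have := (pow_pos ht.1 m).ne'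
    rw [pow_add]
    field_simp
  · rw [integral_sphereEval_mul_eq_zero hd h hY hZ]
    ring

theorem isTDerivChain_coneHarmonic (hd : 1 ≤ d) {m : ℕ} {Y : MvPolynomial (Fin d) ℝ}
    (hY : IsSolidHarmonic m Y) (s k : ℕ) :
    IsTDerivChain s (fun j => (k.descFactorial j : ℝ) • coneHarmonic (d := d) (k - j) Y) where
  slice j _ t _ := memLp_of_continuous_sphere
    (continuous_slice ((continuous_coneHarmonic (k - j) Y).const_smul _) t)
  meas_top := ((continuous_coneHarmonic (k - s) Y).const_smul _).aestronglyMeasurable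
  slice_top := .of_forall fun t => memLp_of_continuous_sphere
    (continuous_slice ((continuous_coneHarmonic (k - s) Y).const_smul _) t)
  deriv j _ n Z hZ t ht := by
    have h1 : Set.EqOn (harmonicCoeff ((k.descFactorial (j + 1) : ℝ) •
        coneHarmonic (d := d) (k - (j + 1)) Y) n Z) (fun v => ((1 / sphereArea d) *
        ∫ ξ, sphereEval Y ξ * sphereEval Z ξ ∂(sphereMeasure d)) *
        ((k.descFactorial (j + 1) : ℝ) * v ^ (k - (j + 1)))) (Set.uIcc t 1) := by
      intro v hv
      rw [Set.uIcc_of_le ht.2] at hv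
      exact harmonicCoeff_coneHarmonic hd hY hZ _ _ ⟨ht.1.trans_le hv.1, hv.2⟩
    have h2 : Continuous (fun v : ℝ => ((1 / sphereArea d) *
        ∫ ξ, sphereEval Y ξ * sphereEval Z ξ ∂(sphereMeasure d)) *
        ((k.descFactorial (j + 1) : ℝ) * v ^ (k - (j + 1)))) := by fun_prop
    refine ⟨(h2.intervalIntegrable t 1).congr (h1.symm.mono Set.uIoc_subset_uIcc), ?_⟩
    rw [intervalIntegral.integral_congr h1, harmonicCoeff_coneHarmonic hd hY hZ _ _ ht,
      harmonicCoeff_coneHarmonic hd hY hZ _ _ ⟨one_pos, le_rfl⟩,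
      intervalIntegral.integral_const_mul, intervalIntegral.integral_const_mul, integral_pow,
      ← mul_sub]
    congr 1
    -- When `j ≥ k` the truncated exponents are harmless: `t^(k-j)` is constant and the next falling
    -- factorial is zero.
    rcases Nat.lt_or_ge j k with hjk | hjk
    · rw [Nat.descFactorial_succ, show k - (j + 1) + 1 = k - j by omega]
      have h3 : ((k - (j + 1) : ℕ) : ℝ) + 1 = ((k - j : ℕ) : ℝ) := by
        rw [← Nat.cast_succ]; congr 1; omega
      have h4 : ((k - j : ℕ) : ℝ) ≠ 0 := by
        rw [Nat.cast_ne_zero]; omega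
      rw [h3, Nat.cast_mul]
      field_simp
    · rw [Nat.sub_eq_zero_of_le hjk, Nat.descFactorial_of_lt (Nat.lt_succ_of_le hjk)]
      simp

theorem memConeSobolev_coneHarmonic (hd : 1 ≤ d) {β : ℝ} (hβ : -(d : ℝ) < β) {s : ℕ} (hs : 1 ≤ s)
    {m : ℕ} {Y : MvPolynomial (Fin d) ℝ} (hY : IsSolidHarmonic m Y) (k : ℕ) :
    MemConeSobolev β s (coneHarmonic (d := d) k Y) := by
  have h1 := isTDerivChain_coneHarmonic hd hY s k
  have h2 := (h1.tDeriv_ae hd hs).2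
  simp only [Nat.descFactorial_zero, Nat.cast_one, one_smul, Nat.sub_zero] at h2
  refine ⟨continuous_coneHarmonic k Y, ⟨_, by simp, h1⟩, ?_⟩
  have : IsFiniteMeasure (weightedConeMeasure d (β + s) 0) :=
    isFiniteMeasure_weightedCone hd (by linarith [(Nat.cast_nonneg s : (0 : ℝ) ≤ s)]) le_rfl
  exact (memLp_of_continuous_cone
    ((continuous_coneHarmonic (k - s) Y).const_smul _)).ae_eq
    (ae_weightedCone_of_ae (EventuallyEq.symm h2) _ _)

theorem IsConePoly.memConeSobolev (hd : 1 ≤ d) {β : ℝ} (hβ : -(d : ℝ) < β) {s : ℕ} (hs : 1 ≤ s)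
    {n : ℕ} {q : ConeSurface d → ℝ} (hq : IsConePoly n q) : MemConeSobolev β s q := by
  rw [← mem_conePolys, conePolys_eq_span hd] at hq
  have h0 : MemConeSobolev β s (0 : ConeSurface d → ℝ) := by
    have h1 : IsSolidHarmonic 0 (0 : MvPolynomial (Fin d) ℝ) :=
      ⟨isHomogeneous_zero _ _ _, by simp⟩
    have := memConeSobolev_coneHarmonic hd hβ hs h1 0
    have e : coneHarmonic (d := d) 0 0 = 0 := by funext p; simp [coneHarmonic]
    rwa [e] at this
  induction hq using Submodule.span_induction with
  | mem q hq =>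
    obtain ⟨k, m, Y, -, hY, rfl⟩ := hq
    exact memConeSobolev_coneHarmonic hd hβ hs hY k
  | zero => exact h0
  | add p q _ _ hp hq => simpa using hp.add_smul hd hs hq 1 1
  | smul c q _ hq => simpa using hq.add_smul hd hs h0 c 0

end TDerivatives

/-! ### Existence and uniqueness of orthogonal projections -/

section Projections

variable {d : ℕ}

/-- A symmetric bilinear form on functions on the cone that is definite on polynomials. -/
structure IsPolyInner (ip : (ConeSurface d → ℝ) → (ConeSurface d → ℝ) → ℝ) : Prop where
  comm : ∀ f g, ip f g = ip g f
  add_smul : ∀ {n : ℕ} {f g h : ConeSurface d → ℝ}, IsConePoly n f → IsConePoly n g →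
    IsConePoly n h → ∀ a b : ℝ, ip (a • f + b • g) h = a * ip f h + b * ip g h
  definite : ∀ {n : ℕ} {q : ConeSurface d → ℝ}, IsConePoly n q → ip q q = 0 → q = 0

theorem isConePoly_zero (n : ℕ) : IsConePoly n (0 : ConeSurface d → ℝ) :=
  mem_conePolys.1 (Submodule.zero_mem _)

theorem IsConePoly.add_smul {n : ℕ} {f g : ConeSurface d → ℝ} (hf : IsConePoly n f)
    (hg : IsConePoly n g) (a b : ℝ) : IsConePoly n (a • f + b • g) := by
  rw [← mem_conePolys] at *
  exact Submodule.add_mem _ (Submodule.smul_mem _ _ hf) (Submodule.smul_mem _ _ hg)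

namespace IsPolyInner

variable {ip : (ConeSurface d → ℝ) → (ConeSurface d → ℝ) → ℝ}

theorem zero_left (h : IsPolyInner ip) {n : ℕ} {r : ConeSurface d → ℝ} (hr : IsConePoly n r) :
    ip 0 r = 0 := by
  simpa using h.add_smul (isConePoly_zero n) (isConePoly_zero n) hr 0 0

/-- The orthogonal polynomials of degree `n`, as a vector space. -/
def orthSubmodule (h : IsPolyInner ip) (n : ℕ) : Submodule ℝ (ConeSurface d → ℝ) where
  carrier := orthPolys ip n
  zero_mem' := ⟨isConePoly_zero n, fun _ _ _ hr => h.zero_left hr⟩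
  add_mem' := by
    intro p q hp hq
    refine ⟨by simpa using hp.1.add_smul hq.1 1 1, fun m hm r hr => ?_⟩
    have := h.add_smul hp.1 hq.1 (hr.mono hm.le) 1 1
    simpa [hp.2 m hm r hr, hq.2 m hm r hr] using this
  smul_mem' := by
    intro c p hp
    refine ⟨by simpa using hp.1.add_smul hp.1 c 0, fun m hm r hr => ?_⟩
    have := h.add_smul hp.1 hp.1 (hr.mono hm.le) c 0
    simpa [hp.2 m hm r hr] using this

theorem finite_orthSubmodule (h : IsPolyInner ip) (n : ℕ) :
    Module.Finite ℝ (h.orthSubmodule n) := by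
  have hle : h.orthSubmodule n ≤ conePolys d n := fun q hq => mem_conePolys.2 hq.1
  exact Submodule.finiteDimensional_of_le hle

theorem isOrthProj_unique (h : IsPolyInner ip) {n : ℕ} {f p q : ConeSurface d → ℝ}
    (hp : IsOrthProj ip (orthPolys ip n) f p) (hq : IsOrthProj ip (orthPolys ip n) f q) :
    p = q := by
  have hmem : p - q ∈ orthPolys ip n := (h.orthSubmodule n).sub_mem hp.1 hq.1
  have h1 := h.add_smul hp.1.1 hq.1.1 hmem.1 1 (-1)
  have h2 : (1 : ℝ) • p + (-1 : ℝ) • q = p - q := by simp [sub_eq_add_neg]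
  rw [h2, ← hp.2 _ hmem, ← hq.2 _ hmem] at h1
  exact sub_eq_zero.1 (h.definite hmem.1 (by rw [h1]; ring))

theorem orthProj_eq (h : IsPolyInner ip) {n : ℕ} {f p : ConeSurface d → ℝ}
    (hp : IsOrthProj ip (orthPolys ip n) f p) : orthProj ip (orthPolys ip n) f = p := by
  have hex : ∃ p, IsOrthProj ip (orthPolys ip n) f p := ⟨p, hp⟩
  rw [orthProj, dif_pos hex]
  exact h.isOrthProj_unique hex.choose_spec hp

/-- Finite-dimensional Riesz representation: definiteness makes the map to the dual injective, hence
surjective. About `f` only the linearity of `ip f` on polynomials matters. -/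
theorem exists_isOrthProj (h : IsPolyInner ip) (n : ℕ) {f : ConeSurface d → ℝ}
    (hf : ∀ u v : ConeSurface d → ℝ, IsConePoly n u → IsConePoly n v → ∀ a b : ℝ,
      ip f (a • u + b • v) = a * ip f u + b * ip f v) :
    ∃ p, IsOrthProj ip (orthPolys ip n) f p := by
  have := h.finite_orthSubmodule n
  let B : h.orthSubmodule n →ₗ[ℝ] h.orthSubmodule n →ₗ[ℝ] ℝ :=
    LinearMap.mk₂ ℝ (fun u v => ip u.1 v.1)
      (fun u v w => by simpa using h.add_smul u.2.1 v.2.1 w.2.1 1 1)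
      (fun c u w => by simpa using h.add_smul u.2.1 u.2.1 w.2.1 c 0)
      (fun u v w => by
        simpa [h.comm u.1] using h.add_smul v.2.1 w.2.1 u.2.1 1 1)
      (fun c u w => by
        simpa [h.comm u.1] using h.add_smul w.2.1 w.2.1 u.2.1 c 0)
  let L : h.orthSubmodule n →ₗ[ℝ] ℝ :=
    { toFun := fun v => ip f v.1
      map_add' := fun u v => by simpa using hf u.1 v.1 u.2.1 v.2.1 1 1
      map_smul' := fun c u => by simpa using hf u.1 u.1 u.2.1 u.2.1 c 0 }
  have hinj : Function.Injective B := by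
    rw [← LinearMap.ker_eq_bot, LinearMap.ker_eq_bot']
    intro u hu
    exact Subtype.ext (h.definite u.2.1 (DFunLike.congr_fun hu u))
  have hsurj : Function.Surjective B :=
    (LinearMap.injective_iff_surjective_of_finrank_eq_finrank
      (Subspace.dual_finrank_eq (K := ℝ) (V := h.orthSubmodule n)).symm).1 hinj
  obtain ⟨p, hp⟩ := hsurj L
  exact ⟨p.1, p.2, fun v hv => (DFunLike.congr_fun hp ⟨v, hv⟩).symm⟩

end IsPolyInner

theorem coneNormConst_pos (hd : 1 ≤ d) {β : ℝ} (hβ : -(d : ℝ) < β) {s : ℕ} :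
    0 < coneNormConst d β s := by
  have hs : (0 : ℝ) ≤ s := Nat.cast_nonneg s
  exact mul_pos (one_div_pos.2 (sphereArea_pos hd)) (div_pos (Real.Gamma_pos_of_pos (by linarith))
    (mul_pos (Real.Gamma_pos_of_pos (by linarith)) (Real.Gamma_pos_of_pos (by linarith))))

theorem coneInner_comm (β γ : ℝ) (f g : ConeSurface d → ℝ) :
    coneInner β γ f g = coneInner β γ g f := by
  simp only [coneInner, mul_comm]

theorem coneInner_add_smul {β γ : ℝ} {f g h : ConeSurface d → ℝ}
    (hf : MemLp f 2 (weightedConeMeasure d β γ)) (hg : MemLp g 2 (weightedConeMeasure d β γ))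
    (hh : MemLp h 2 (weightedConeMeasure d β γ)) (a b : ℝ) :
    coneInner β γ (a • f + b • g) h = a * coneInner β γ f h + b * coneInner β γ g h := by
  have e : ∀ p, (a • f + b • g) p * h p = a * (f p * h p) + b * (g p * h p) := by
    intro p; simp; ring
  simp only [coneInner, e]
  rw [integral_add ((hf.integrable_fun_mul hh).const_mul a)
    ((hg.integrable_fun_mul hh).const_mul b), integral_const_mul, integral_const_mul]
  ring

theorem IsConePoly.memLp_weightedCone (hd : 1 ≤ d) {β γ : ℝ} (hβ : -(d : ℝ) < β) (hγ : 0 ≤ γ)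
    {n : ℕ} {q : ConeSurface d → ℝ} (hq : IsConePoly n q) :
    MemLp q 2 (weightedConeMeasure d β γ) := by
  have := isFiniteMeasure_weightedCone hd hβ hγ
  exact memLp_of_continuous_cone hq.continuous

theorem isPolyInner_coneInner (hd : 1 ≤ d) {β : ℝ} (hβ : -(d : ℝ) < β) (s : ℕ) :
    IsPolyInner (coneInner (d := d) β s) where
  comm := coneInner_comm β s
  add_smul hf hg hh a b := coneInner_add_smul
    (hf.memLp_weightedCone hd hβ (Nat.cast_nonneg s))
    (hg.memLp_weightedCone hd hβ (Nat.cast_nonneg s))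
    (hh.memLp_weightedCone hd hβ (Nat.cast_nonneg s)) a b
  definite {n q} hq h0 := by
    have hL := hq.memLp_weightedCone hd hβ (Nat.cast_nonneg s)
    have h1 := (mul_eq_zero.1 h0).resolve_left (coneNormConst_pos hd hβ).ne'
    rw [integral_eq_zero_iff_of_nonneg (fun p => mul_self_nonneg _)
      (hL.integrable_fun_mul hL)] at h1
    have h2 := ae_of_ae_weightedCone h1
    funext p
    refine eq_zero_of_conePoint_eq_zero hd hq.continuous (fun t ht ξ => ?_) p
    have h3 : ∀ᵐ t ∂((volume : Measure ℝ).restrict (Set.Ioc 0 1)),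
        ∀ ξ : UnitSphere d, q (conePoint t ξ) = 0 := by
      filter_upwards [h2] with t ht
      refine slice_eq_zero_of_ae hq.continuous ?_
      filter_upwards [ht] with ξ hξ
      simpa using hξ
    refine Measure.eqOn_Ioc_of_ae_eq (μ := volume) (f := fun t => q (conePoint t ξ))
      (g := fun _ => (0 : ℝ)) (a := 0) (b := 1) ?_
      (hq.continuous.comp ((continuous_conePoint d).comp (Continuous.prodMk_left ξ))).continuousOn
      continuousOn_const ⟨ht.1, ht.2.le⟩
    filter_upwards [h3] with t ht using ht ξ

theorem isPolyInner_coneSobolevInner (hd : 1 ≤ d) {β : ℝ} (hβ : -(d : ℝ) < β) {s : ℕ}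
    (hs : 1 ≤ s) {lam : ℕ → ℝ} (hlam : ∀ k < s, 0 < lam k) :
    IsPolyInner (coneSobolevInner (d := d) β s lam) where
  comm := coneSobolevInner_comm β s lam
  add_smul hf hg hh a b := coneSobolevInner_add_smul hd hs lam (hf.memConeSobolev hd hβ hs)
    (hg.memConeSobolev hd hβ hs) (hh.memConeSobolev hd hβ hs) a b
  definite hq h0 := coneSobolevInner_self_eq_zero hd hs hlam (hq.memConeSobolev hd hβ hs) h0

end Projections

/-! ### Duality between the two inner products -/

section Duality

open MvPolynomial

variable {d : ℕ}

theorem sq_integral_mul_le {α : Type*} [MeasurableSpace α] {μ : Measure α} {f g : α → ℝ}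
    (hf : MemLp f 2 μ) (hg : MemLp g 2 μ) :
    (∫ x, f x * g x ∂μ) ^ 2 ≤ (∫ x, f x ^ 2 ∂μ) * ∫ x, g x ^ 2 ∂μ := by
  have h : ∀ y : ℝ, 0 ≤ (∫ x, g x ^ 2 ∂μ) * (y * y) + (2 * ∫ x, f x * g x ∂μ) * y +
      ∫ x, f x ^ 2 ∂μ := by
    intro y
    have h1 : ∫ x, (f x + y * g x) ^ 2 ∂μ = (∫ x, g x ^ 2 ∂μ) * (y * y) +
        (2 * ∫ x, f x * g x ∂μ) * y + ∫ x, f x ^ 2 ∂μ := by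
      have e : ∀ x, (f x + y * g x) ^ 2 =
          (y * y) * g x ^ 2 + (2 * y) * (f x * g x) + f x ^ 2 := fun x => by ring
      simp only [e]
      have i1 := hg.integrable_sq.const_mul (y * y)
      have i2 := (hf.integrable_fun_mul hg).const_mul (2 * y)
      have i3 : Integrable (fun x => (y * y) * g x ^ 2 + (2 * y) * (f x * g x)) μ := i1.add i2
      rw [integral_add i3 hf.integrable_sq, integral_add i1 i2, integral_const_mul,
        integral_const_mul]
      ring
    rw [← h1]
    exact integral_nonneg fun x => sq_nonneg _
  have := discrim_le_zero h
  rw [discrim] at this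
  nlinarith

/-- `f ∈ W_2^s` is `(1-t)^s g` with `g` square integrable, and vanishes to order `s` at the rim. -/
structure IsRimPair (β : ℝ) (s : ℕ) (f g : ConeSurface d → ℝ) : Prop where
  sobolev : MemConeSobolev β s f
  memLp : MemLp g 2 (weightedConeMeasure d β s)
  eq_mul : ∀ p : ConeSurface d, f p = (1 - p.1.2) ^ s * g p
  rim : Tendsto
    (fun t : ℝ => ∫ ξ : UnitSphere d, ((1 - t) * g (conePoint t ξ)) ^ 2 ∂(sphereMeasure d))
    (𝓝[<] 1) (𝓝 0)

/-- Lets the duality identity be applied with polynomials in the role of `g`; the rim condition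
holds because `q` is bounded. -/
theorem IsConePoly.isRimPair (hd : 1 ≤ d) {β : ℝ} (hβ : -(d : ℝ) < β) {s : ℕ} (hs : 1 ≤ s)
    {n : ℕ} {q : ConeSurface d → ℝ} (hq : IsConePoly n q) :
    IsRimPair β s (fun p => (1 - p.1.2) ^ s * q p) q where
  sobolev := (hq.one_sub_pow_mul s).memConeSobolev hd hβ hs
  memLp := hq.memLp_weightedCone hd hβ (Nat.cast_nonneg s)
  eq_mul _ := rfl
  rim := by
    obtain ⟨C, hC⟩ := isCompact_univ.exists_bound_of_continuousOn hq.continuous.continuousOn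
    have hlim : Tendsto (fun t : ℝ => (1 - t) ^ 2 * (C ^ 2 * (sphereMeasure d).real Set.univ))
        (𝓝[<] 1) (𝓝 0) := by
      have : Tendsto (fun t : ℝ => (1 - t) ^ 2 * (C ^ 2 * (sphereMeasure d).real Set.univ))
          (𝓝 1) (𝓝 ((1 - 1) ^ 2 * (C ^ 2 * (sphereMeasure d).real Set.univ))) :=
        ((tendsto_const_nhds.sub tendsto_id).pow 2).mul_const _
      simpa using this.mono_left nhdsWithin_le_nhds
    refine squeeze_zero (fun t => integral_nonneg fun ξ => sq_nonneg _) (fun t => ?_) hlim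
    have h1 : ∀ ξ : UnitSphere d, ((1 - t) * q (conePoint t ξ)) ^ 2 ≤ (1 - t) ^ 2 * C ^ 2 := by
      intro ξ
      rw [mul_pow]
      refine mul_le_mul_of_nonneg_left ?_ (sq_nonneg _)
      have := hC (conePoint t ξ) trivial
      rw [Real.norm_eq_abs] at this
      exact sq_le_sq' (abs_le.1 this).1 (abs_le.1 this).2
    have hi : Integrable (fun ξ : UnitSphere d => ((1 - t) * q (conePoint t ξ)) ^ 2)
        (sphereMeasure d) :=
      (memLp_of_continuous_sphere
        (continuous_const.mul (continuous_slice hq.continuous t))).integrable_sq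
    refine (integral_mono hi (integrable_const _) h1).trans_eq ?_
    rw [integral_const, smul_eq_mul]
    ring

namespace IsRimPair

variable {β : ℝ} {s : ℕ} {f g : ConeSurface d → ℝ}

theorem harmonicCoeff_eq_mul (h : IsRimPair β s f g) (m : ℕ) (Y : MvPolynomial (Fin d) ℝ) {t : ℝ}
    (ht : t ∈ Set.Ioc (0 : ℝ) 1) :
    harmonicCoeff f m Y t = (1 - t) ^ s * harmonicCoeff g m Y t := by
  simp only [harmonicCoeff_eq, h.eq_mul, conePoint_val ht.1.le ht.2, mul_assoc]
  rw [integral_const_mul]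
  ring

/-- The quotient is the coefficient of `(1-t) g`, which Cauchy–Schwarz bounds by the slice norm in
the rim condition. -/
theorem tendsto_harmonicCoeff_div (h : IsRimPair β s f g) (hs : 1 ≤ s) (m : ℕ)
    (Y : MvPolynomial (Fin d) ℝ) :
    Tendsto (fun t => harmonicCoeff f m Y t / (1 - t) ^ (s - 1)) (𝓝[<] 1) (𝓝 0) := by
  set J := ∫ ξ, sphereEval Y ξ ^ 2 ∂(sphereMeasure d)
  have hmem : ∀ᶠ t : ℝ in 𝓝[<] 1, t ∈ Set.Ioo (0 : ℝ) 1 := by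
    filter_upwards [mem_nhdsWithin_of_mem_nhds (Ioi_mem_nhds one_pos), self_mem_nhdsWithin]
      with t h1 h2
    exact ⟨h1, h2⟩
  have hlim : Tendsto (fun t : ℝ => ((t ^ m)⁻¹ * (1 / sphereArea d)) ^ 2 *
      ((∫ ξ : UnitSphere d, ((1 - t) * g (conePoint t ξ)) ^ 2 ∂(sphereMeasure d)) * J))
      (𝓝[<] 1) (𝓝 ((((1 : ℝ) ^ m)⁻¹ * (1 / sphereArea d)) ^ 2 * (0 * J))) := by
    refine Tendsto.mul (Tendsto.mono_left ?_ nhdsWithin_le_nhds) (h.rim.mul_const J)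
    exact (((tendsto_id.pow m).inv₀ (by simp)).mul_const _).pow 2
  rw [zero_mul, mul_zero] at hlim
  have hsq : Tendsto (fun t => (harmonicCoeff f m Y t / (1 - t) ^ (s - 1)) ^ 2)
      (𝓝[<] 1) (𝓝 0) := by
    refine squeeze_zero' (.of_forall fun t => sq_nonneg _) ?_ hlim
    filter_upwards [hmem] with t ht
    have ht1 : (1 - t) ≠ 0 := by linarith [ht.2]
    -- Below the rim `g` is a quotient of the continuous `f`, so each of its slices is in `L²`, not
    -- merely almost every one.
    have hslice : ∀ ξ : UnitSphere d, (1 - t) * g (conePoint t ξ) =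
        f (conePoint t ξ) / (1 - t) ^ (s - 1) := by
      intro ξ
      rw [h.eq_mul, conePoint_val ht.1.le ht.2.le, eq_div_iff (pow_ne_zero _ ht1)]
      obtain ⟨r, rfl⟩ : ∃ r, s = r + 1 := ⟨s - 1, by omega⟩
      rw [Nat.add_sub_cancel, pow_succ]
      ring
    have hL : MemLp (fun ξ : UnitSphere d => (1 - t) * g (conePoint t ξ)) 2 (sphereMeasure d) := by
      simp only [hslice]
      exact memLp_of_continuous_sphere ((continuous_slice h.sobolev.1 t).div_const _)
    have e : harmonicCoeff f m Y t / (1 - t) ^ (s - 1) = ((t ^ m)⁻¹ * (1 / sphereArea d)) *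
        ∫ ξ, ((1 - t) * g (conePoint t ξ)) * sphereEval Y ξ ∂(sphereMeasure d) := by
      simp only [hslice, div_mul_eq_mul_div]
      rw [integral_div, harmonicCoeff_eq]
      ring
    rw [e, mul_pow]
    exact mul_le_mul_of_nonneg_left (sq_integral_mul_le hL (memLp_sphereEval Y)) (sq_nonneg _)
  have := hsq.sqrt
  simp only [Real.sqrt_sq_eq_abs, Real.sqrt_zero] at this
  exact (tendsto_zero_iff_abs_tendsto_zero _).2 this

theorem harmonicCoeff_rim_eq_zero (h : IsRimPair β s f g) (hs : 1 ≤ s) {m : ℕ}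
    {Y : MvPolynomial (Fin d) ℝ} (hY : IsSolidHarmonic m Y) :
    ∀ k < s, harmonicCoeff (tDeriv s f k) m Y 1 = 0 := by
  obtain ⟨h0, hc⟩ := h.sobolev.2.1.tDeriv_spec
  refine (hc.isACChain hY).eq_zero_of_rim ?_
  simp only [h0]
  exact h.tendsto_harmonicCoeff_div hs m Y

end IsRimPair

theorem radialWeight_mul_pow (hd : 1 ≤ d) (β γ : ℝ) (i m : ℕ) {t : ℝ} (ht : 0 < t) :
    radialWeight d β γ t * (t ^ (i + m) * t ^ m) =
      t ^ (β + (d - 1) + i + 2 * m) * (1 - t) ^ γ := by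
  have e : β + (d - 1) + i + 2 * m = β + ((d - 1 : ℕ) : ℝ) + (i + m : ℕ) + m := by
    rw [Nat.cast_sub hd]; push_cast; ring
  rw [e, Real.rpow_add ht, Real.rpow_add ht, Real.rpow_add ht, Real.rpow_natCast,
    Real.rpow_natCast, Real.rpow_natCast, radialWeight]
  ring

/-- In the exponent, one `m` comes from the homogeneity of `Y` and the other from the normalization
of `harmonicCoeff`. -/
theorem integral_mul_coneHarmonic (hd : 1 ≤ d) {β γ : ℝ} {F : ConeSurface d → ℝ} {i m : ℕ}
    {Y : MvPolynomial (Fin d) ℝ} (hY : IsSolidHarmonic m Y)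
    (hF : Integrable (fun p => F p * coneHarmonic i Y p) (weightedConeMeasure d β γ)) :
    IntegrableOn (fun t => harmonicCoeff F m Y t * (t ^ (β + (d - 1) + i + 2 * m) * (1 - t) ^ γ))
      (Set.Ioc 0 1) ∧
    ∫ p, F p * coneHarmonic i Y p ∂(weightedConeMeasure d β γ) = sphereArea d *
      ∫ t in Set.Ioc 0 1, harmonicCoeff F m Y t *
        (t ^ (β + (d - 1) + i + 2 * m) * (1 - t) ^ γ) := by
  have hω := (sphereArea_pos hd).ne'
  obtain ⟨h1, h2⟩ := integral_weightedCone hF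
  have e : ∀ t ∈ Set.Ioc (0 : ℝ) 1, radialWeight d β γ t *
      ∫ ξ, F (conePoint t ξ) * coneHarmonic i Y (conePoint t ξ) ∂(sphereMeasure d) =
      sphereArea d * (harmonicCoeff F m Y t *
        (t ^ (β + (d - 1) + i + 2 * m) * (1 - t) ^ γ)) := by
    intro t ht
    simp only [coneHarmonic_conePoint hY ht, mul_left_comm _ (t ^ (i + m))]
    rw [integral_const_mul, integral_slice_eq hd F m Y ht.1, ← radialWeight_mul_pow hd β γ i m ht.1]
    ring
  rw [integrableOn_congr_fun e measurableSet_Ioc] at h1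
  refine ⟨?_, ?_⟩
  · have := h1.const_mul (sphereArea d)⁻¹
    simpa only [IntegrableOn, inv_mul_cancel_left₀ hω] using this
  · rw [h2, setIntegral_congr_fun measurableSet_Ioc e, integral_const_mul]

/-- The Sobolev inner product of `f = (1-t)^s g` with a polynomial is an inner product of `g`
with a polynomial whose degree is lower by `s`. -/
theorem exists_dual_conePoly (hd : 1 ≤ d) {β : ℝ} (hβ : -(d : ℝ) < β) {s : ℕ} (hs : 1 ≤ s)
    (lam : ℕ → ℝ) {n : ℕ} {v : ConeSurface d → ℝ} (hv : IsConePoly n v) :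
    ∃ w : ConeSurface d → ℝ, IsConePoly (n - s) w ∧ (n < s → w = 0) ∧
      ∀ f g : ConeSurface d → ℝ, IsRimPair β s f g →
        coneSobolevInner β s lam f v = coneInner β s g w := by
  have hω := sphereArea_pos hd
  rw [← mem_conePolys, conePolys_eq_span hd] at hv
  -- The polynomials having a dual are closed under linear combinations, so only `t^k Y` has to be
  -- treated.
  have hcomb : ∀ {u v w z : ConeSurface d → ℝ} (a b : ℝ),
      u ∈ Submodule.span ℝ (coneHarmonics d n) → v ∈ Submodule.span ℝ (coneHarmonics d n) →
      (IsConePoly (n - s) w ∧ (n < s → w = 0) ∧ ∀ f g : ConeSurface d → ℝ, IsRimPair β s f g →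
        coneSobolevInner β s lam f u = coneInner β s g w) →
      (IsConePoly (n - s) z ∧ (n < s → z = 0) ∧ ∀ f g : ConeSurface d → ℝ, IsRimPair β s f g →
        coneSobolevInner β s lam f v = coneInner β s g z) →
      (IsConePoly (n - s) (a • w + b • z) ∧ (n < s → a • w + b • z = 0) ∧
        ∀ f g : ConeSurface d → ℝ, IsRimPair β s f g →
        coneSobolevInner β s lam f (a • u + b • v) = coneInner β s g (a • w + b • z)) := by
    intro u v w z a b hu hv hw hz
    rw [← conePolys_eq_span hd, mem_conePolys] at hu hv
    refine ⟨hw.1.add_smul hz.1 a b, fun h => by rw [hw.2.1 h, hz.2.1 h]; simp,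
      fun f g hfg => ?_⟩
    rw [coneSobolevInner_comm, coneInner_comm, coneSobolevInner_add_smul hd hs lam
      (hu.memConeSobolev hd hβ hs) (hv.memConeSobolev hd hβ hs) hfg.sobolev,
      coneInner_add_smul (hw.1.memLp_weightedCone hd hβ (Nat.cast_nonneg s))
        (hz.1.memLp_weightedCone hd hβ (Nat.cast_nonneg s)) hfg.memLp,
      coneSobolevInner_comm, hw.2.2 f g hfg, coneInner_comm,
      coneSobolevInner_comm β s lam v, hz.2.2 f g hfg, coneInner_comm _ _ g z]
  induction hv using Submodule.span_induction with
  | zero =>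
    refine ⟨0, isConePoly_zero _, fun _ => rfl, fun f g hfg => ?_⟩
    rw [coneSobolevInner_comm]
    have h2 := coneSobolevInner_add_smul hd hs lam
      ((isConePoly_zero 0).memConeSobolev hd hβ hs) ((isConePoly_zero 0).memConeSobolev hd hβ hs)
      hfg.sobolev 0 0
    simpa [coneInner] using h2
  | add u v hu hv ihu ihv =>
    obtain ⟨w, hw⟩ := ihu
    obtain ⟨z, hz⟩ := ihv
    exact ⟨_, by simpa using hcomb 1 1 hu hv hw hz⟩
  | smul c u hu ihu =>
    obtain ⟨w, hw⟩ := ihu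
    have h := hcomb c 0 hu hu hw hw
    simp only [zero_smul, add_zero] at h
    exact ⟨_, h⟩
  | mem v hv =>
    obtain ⟨k, m, Y, hkm, hY, rfl⟩ := hv
    have hchain := isTDerivChain_coneHarmonic hd hY s k
    have htd := hchain.tDeriv_ae hd hs
    simp only [Nat.descFactorial_zero, Nat.cast_one, one_smul, Nat.sub_zero] at htd
    -- On the rim the derivatives of `t^k Y` are multiples of `Y`, so each rim term is a multiple of
    -- a coefficient of `∂_t^j f` at `1`, which is zero.
    have hinner : ∀ f g : ConeSurface d → ℝ, IsRimPair β s f g →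
        coneSobolevInner β s lam f (coneHarmonic k Y) = (1 / sphereArea d) *
          ((k.descFactorial s : ℝ) * ∫ p, tDeriv s f s p * coneHarmonic (k - s) Y p
            ∂(weightedConeMeasure d (β + s) 0)) := by
      intro f g hfg
      rw [coneSobolevInner, Finset.sum_eq_zero, add_zero]
      · congr 1
        rw [← integral_const_mul]
        refine integral_congr_ae ?_
        filter_upwards [ae_weightedCone_of_ae htd.2 _ _] with p hp
        rw [hp]
        simp only [Pi.smul_apply, smul_eq_mul]
        ring
      · intro j hj
        have hj := Finset.mem_range.1 hj
        have h1 : (1 : ℝ) ∈ Set.Ioc (0 : ℝ) 1 := ⟨one_pos, le_rfl⟩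
        have h2 : ∫ ξ : UnitSphere d, tDeriv s f j (conePoint 1 ξ) *
            tDeriv s (coneHarmonic k Y) j (conePoint 1 ξ) ∂(sphereMeasure d) =
            ∫ ξ : UnitSphere d, (k.descFactorial j : ℝ) *
              (tDeriv s f j (conePoint 1 ξ) * sphereEval Y ξ) ∂(sphereMeasure d) := by
          refine integral_congr_ae ?_
          filter_upwards [htd.1 j hj 1 h1] with ξ hξ
          rw [hξ]
          simp only [Pi.smul_apply, smul_eq_mul, coneHarmonic_conePoint hY h1, one_pow]
          ring
        rw [h2, integral_const_mul, integral_slice_eq hd _ m Y one_pos,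
          hfg.harmonicCoeff_rim_eq_zero hs hY j hj]
        ring
    rcases Nat.lt_or_ge k s with hks | hks
    · refine ⟨0, isConePoly_zero _, fun _ => rfl, fun f g hfg => ?_⟩
      rw [hinner f g hfg, Nat.descFactorial_of_lt hks]
      simp [coneInner]
    · set i := k - s with hi
      set b : ℝ := β + (d - 1) + i + 2 * m with hb
      have hb1 : -1 < b := by
        have h1 : (0 : ℝ) ≤ i := Nat.cast_nonneg i
        have h2 : (0 : ℝ) ≤ m := Nat.cast_nonneg m
        rw [hb]; linarith
      obtain ⟨c, hc, hmom⟩ := IsACChain.integral_mul_rpow s hb1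
      have hB := coneNormConst_pos (s := s) hd hβ
      have hharm : IsConePoly (n - s) (coneHarmonic (d := d) i Y) := by
        rw [← mem_conePolys, conePolys_eq_span hd]
        exact Submodule.subset_span ⟨i, m, Y, by omega, hY, rfl⟩
      -- The numerator comes from `∂_t^s t^k`; the denominator undoes the integration by parts, the
      -- normalization of the inner product and the factor `ω_d` of the polar formula.
      set a : ℝ := (k.descFactorial s : ℝ) / (c * (coneNormConst d β s * sphereArea d))
      refine ⟨a • coneHarmonic i Y, ?_, fun h => by omega, fun f g hfg => ?_⟩
      · simpa using hharm.add_smul hharm a 0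
      · obtain ⟨h0, hch⟩ := hfg.sobolev.2.1.tDeriv_spec
        have hbs : β + s + (d - 1) + i + 2 * m = b + s := by rw [hb]; ring
        have hβs : -(d : ℝ) < β + s := by linarith [(Nat.cast_nonneg s : (0 : ℝ) ≤ s)]
        obtain ⟨hI1, hI2⟩ := integral_mul_coneHarmonic hd hY
          (hfg.sobolev.2.2.integrable_fun_mul (hharm.memLp_weightedCone hd hβs le_rfl))
        obtain ⟨-, hI4⟩ := integral_mul_coneHarmonic hd hY
          (hfg.memLp.integrable_fun_mul
            (hharm.memLp_weightedCone hd hβ (Nat.cast_nonneg s)))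
        simp only [Real.rpow_zero, mul_one, hbs] at hI1 hI2
        obtain ⟨-, hm⟩ := hmom (fun j => harmonicCoeff (tDeriv s f j) m Y) (hch.isACChain hY)
          (hfg.harmonicCoeff_rim_eq_zero hs hY) hI1
        have hφ : ∫ t in Set.Ioc 0 1, harmonicCoeff g m Y t * (t ^ b * (1 - t) ^ (s : ℝ)) =
            ∫ t in Set.Ioc 0 1, harmonicCoeff (tDeriv s f 0) m Y t * t ^ b := by
          refine setIntegral_congr_fun measurableSet_Ioc fun t ht => ?_
          rw [h0, hfg.harmonicCoeff_eq_mul m Y ht, Real.rpow_natCast]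
          ring
        have hw : ∫ p, g p * (a • coneHarmonic (d := d) i Y) p ∂(weightedConeMeasure d β s) =
            a * ∫ p, g p * coneHarmonic (d := d) i Y p ∂(weightedConeMeasure d β s) := by
          rw [← integral_const_mul]
          refine integral_congr_ae (.of_forall fun p => ?_)
          simp only [Pi.smul_apply, smul_eq_mul]
          ring
        rw [hinner f g hfg, hI2, coneInner, hw, hI4, hφ, hm]
        have hB' := hB.ne'
        have hω' := hω.ne'
        simp only [a]
        field_simp

end Duality

/-! ### Transfer of projections -/

section SobolevProjections

variable {d : ℕ} {β : ℝ} {s : ℕ} {lam : ℕ → ℝ} {f g : ConeSurface d → ℝ}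

/-- The Sobolev projections of degree `n < s` of `f = (1-t)^s g` vanish. -/
theorem isOrthProj_zero (hd : 1 ≤ d) (hβ : -(d : ℝ) < β) (hs : 1 ≤ s) (hlam : ∀ k < s, 0 < lam k)
    (hpair : IsRimPair β s f g) {n : ℕ} (hn : n < s) :
    IsOrthProj (coneSobolevInner β s lam) (coneSobolevV d β s lam n) f 0 := by
  have hS : IsPolyInner (coneSobolevInner (d := d) β s lam) :=
    isPolyInner_coneSobolevInner hd hβ hs hlam
  refine ⟨(hS.orthSubmodule n).zero_mem, fun v hv => ?_⟩
  obtain ⟨w, -, hw0, hw⟩ := exists_dual_conePoly hd hβ hs lam hv.1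
  rw [hw f g hpair, hw0 hn, hS.zero_left hv.1]
  simp [coneInner]

/-- The Sobolev projections of `f = (1-t)^s g` are `(1-t)^s` times the projections of `g`. -/
theorem isOrthProj_one_sub_pow_mul (hd : 1 ≤ d) (hβ : -(d : ℝ) < β) (hs : 1 ≤ s)
    (hpair : IsRimPair β s f g) {n : ℕ} (hn : s ≤ n) {q : ConeSurface d → ℝ}
    (hq : IsOrthProj (coneInner β s) (coneV d β s (n - s)) g q) :
    IsOrthProj (coneSobolevInner β s lam) (coneSobolevV d β s lam n) f
      (fun p => (1 - p.1.2) ^ s * q p) := by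
  have hqp := hq.1.1.isRimPair hd hβ hs
  refine ⟨⟨?_, fun m hm r hr => ?_⟩, fun v hv => ?_⟩
  · have := hq.1.1.one_sub_pow_mul s
    rwa [Nat.sub_add_cancel hn] at this
  · obtain ⟨w, hwp, hw0, hw⟩ := exists_dual_conePoly hd hβ hs lam hr
    rw [hw _ q hqp]
    -- For `m < s` the truncated degree `m - s` says nothing, so `w = 0` is used instead.
    rcases Nat.lt_or_ge m s with hms | hms
    · rw [hw0 hms]; simp [coneInner]
    · exact hq.1.2 (m - s) (by omega) w hwp
  · obtain ⟨w, hwp, -, hw⟩ := exists_dual_conePoly hd hβ hs lam hv.1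
    rw [hw f g hpair, hw _ q hqp]
    -- The dual `w` is itself orthogonal to lower degrees: pairing it with `r` is the Sobolev
    -- pairing of `v` with `(1-t)^s r`, whose degree is below `n`.
    refine hq.2 w ⟨hwp, fun m hm r hr => ?_⟩
    rw [coneInner_comm, ← hw _ r (hr.isRimPair hd hβ hs), coneSobolevInner_comm]
    exact hv.2 (m + s) (by omega) _ (hr.one_sub_pow_mul s)

end SobolevProjections

end

theorem mainTheorem7 (d : ℕ) (hd : 1 ≤ d) (s : ℕ) (hs : 1 ≤ s) (β : ℝ) (hβ : -(d : ℝ) < β)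
    (lam : ℕ → ℝ) (hlam : ∀ k < s, 0 < lam k)
    (f g : ConeSurface d → ℝ)
    (hf : MemConeSobolev β s f)
    (hg : MemLp g 2 (weightedConeMeasure d β s))
    (hfg : ∀ p : ConeSurface d, f p = (1 - p.1.2) ^ s * g p)
    (hrim : Tendsto
      (fun t : ℝ => ∫ ξ : UnitSphere d, ((1 - t) * g (conePoint t ξ)) ^ 2 ∂(sphereMeasure d))
      (𝓝[<] 1) (𝓝 0)) :
    ∀ n : ℕ,
      (∃! q, IsOrthProj (coneSobolevInner β s lam) (coneSobolevV d β s lam n) f q) ∧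
      (∃! q, IsOrthProj (coneInner β s) (coneV d β s n) g q) ∧
      (s ≤ n → ∀ p : ConeSurface d,
        coneSobolevProj β s lam n f p = (1 - p.1.2) ^ s * coneProj β s (n - s) g p) ∧
      (n < s → ∀ p : ConeSurface d, coneSobolevProj β s lam n f p = 0) := by
  have hpair : IsRimPair β s f g := ⟨hf, hg, hfg, hrim⟩
  have hS : IsPolyInner (coneSobolevInner (d := d) β s lam) :=
    isPolyInner_coneSobolevInner hd hβ hs hlam
  have hI : IsPolyInner (coneInner (d := d) β s) := isPolyInner_coneInner hd hβ s
  have hex : ∀ n, ∃ q, IsOrthProj (coneInner β s) (coneV d β s n) g q := fun n =>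
    hI.exists_isOrthProj n fun u v hu hv a b => by
      rw [coneInner_comm, coneInner_add_smul (hu.memLp_weightedCone hd hβ (Nat.cast_nonneg s))
        (hv.memLp_weightedCone hd hβ (Nat.cast_nonneg s)) hg, coneInner_comm _ _ u,
        coneInner_comm _ _ v]
  have hlow : ∀ n < s, IsOrthProj (coneSobolevInner β s lam) (coneSobolevV d β s lam n) f 0 :=
    fun n hn => isOrthProj_zero hd hβ hs hlam hpair hn
  have hhigh : ∀ n, s ≤ n → IsOrthProj (coneSobolevInner β s lam) (coneSobolevV d β s lam n) f
      (fun p => (1 - p.1.2) ^ s * coneProj β s (n - s) g p) := by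
    intro n hn
    obtain ⟨q, hq⟩ := hex (n - s)
    have : coneProj β s (n - s) g = q := hI.orthProj_eq hq
    rw [this]
    exact isOrthProj_one_sub_pow_mul hd hβ hs hpair hn hq
  intro n
  refine ⟨?_, ?_, fun hn p => ?_, fun hn p => ?_⟩
  · rcases Nat.lt_or_ge n s with hn | hn
    · exact ⟨_, hlow n hn, fun q hq => hS.isOrthProj_unique hq (hlow n hn)⟩
    · exact ⟨_, hhigh n hn, fun q hq => hS.isOrthProj_unique hq (hhigh n hn)⟩
  · obtain ⟨q, hq⟩ := hex n
    exact ⟨q, hq, fun q' hq' => hI.isOrthProj_unique hq' hq⟩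
  · exact congr_fun (hS.orthProj_eq (hhigh n hn)) p
  · exact congr_fun (hS.orthProj_eq (hlow n hn)) p
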